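/- Let $\mathbb{F}_q$ be a finite field of characteristic different from $2$, and let $C\subset\mathbb{P}^2$ be a smooth plane curve of degree $d\ge 1$ defined over $\mathbb{F}_q$ (smooth over $\overline{\mathbb{F}}_q$). The dual curve $C^{*}\subset(\mathbb{P}^2)^{*}$ is the Zariski closure of the image of the Gauss map $\varphi$ of $C_{\overline{\mathbb{F}}_q}$, which sends a smooth point to its tangent line; let $\varphi'$ be the Gauss map of $C^{*}$ and $C^{**}$ the dual curve of $C^{*}$, where $(\mathbb{P}^2)^{**}$ is identified with $\mathbb{P}^2$. Call $C$ reflexive if $C=C^{**}$ and $\varphi'\circ\varphi$ is the identity (as a rational map); lines are reflexive by convention. If $C$ is reflexive and $d\le q+1$, then there is a line $L\subset\mathbb{P}^2$ defined over $\mathbb{F}_q$ that intersects $C$ transversely, that is, $C\cap L$ consists of exactly $d$ distinct points over $\overline{\mathbb{F}}_q$. -/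

import Mathlib

open scoped LinearAlgebra.Projectivization

noncomputable section

namespace PlaneCurve

/-- The set of points of the projective plane over `K`. Points of the dual plane are written in the
dual coordinates, `[a : b : c]` standing for the line `a X + b Y + c Z = 0`, so that the dual plane
is again `Plane K` and the plane is identified with its double dual. -/
abbrev Plane (K : Type*) [Field K] : Type _ := ℙ K (Fin 3 → K)

/-- The homogeneous polynomial `G` vanishes at every point of `S`. -/
def VanishesOn {K : Type*} [Field K] (G : MvPolynomial (Fin 3) K) (S : Set (Plane K)) : Prop :=
  ∀ P ∈ S, MvPolynomial.eval P.rep G = 0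

/-- The closure of a set of points in the Zariski topology of the plane. -/
def zariskiClosure {K : Type*} [Field K] (S : Set (Plane K)) : Set (Plane K) :=
  {P | ∀ (n : ℕ) (G : MvPolynomial (Fin 3) K), G.IsHomogeneous n → VanishesOn G S →
    MvPolynomial.eval P.rep G = 0}

/-- The points of the plane lying on the line with coordinates `a`. -/
def line {K : Type*} [Field K] (a : Fin 3 → K) : Set (Plane K) :=
  {P | ∑ i, a i * P.rep i = 0}

/-- The embedded tangent space at `P` of the (reduced) closed set `V`, as the linear subspace of
`K ^ 3` on which the differentials at `P` of all equations of `V` vanish. -/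
def tangentSpace {K : Type*} [Field K] (V : Set (Plane K)) (P : Plane K) :
    Submodule K (Fin 3 → K) where
  carrier := {w | ∀ (n : ℕ) (G : MvPolynomial (Fin 3) K), G.IsHomogeneous n → VanishesOn G V →
    ∑ i, MvPolynomial.eval P.rep (MvPolynomial.pderiv i G) * w i = 0}
  zero_mem' := by
    intro n G _ _
    simp
  add_mem' := by
    intro v w hv hw n G hG hV
    have h1 := hv n G hG hV
    have h2 := hw n G hG hV
    simp only [Pi.add_apply, mul_add, Finset.sum_add_distrib, h1, h2, add_zero]
  smul_mem' := by
    intro c w hw n G hG hV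
    have h := hw n G hG hV
    simp only [Pi.smul_apply, smul_eq_mul, mul_left_comm _ c, ← Finset.mul_sum, h, mul_zero]

/-- The graph of the Gauss map of the plane curve `V`: `P` is a smooth point of `V`, that is, the
tangent space of `V` at `P` is a line, and `ℓ` is that tangent line. -/
def GaussMap {K : Type*} [Field K] (V : Set (Plane K)) (P ℓ : Plane K) : Prop :=
  P ∈ V ∧ ∀ w : Fin 3 → K, w ∈ tangentSpace V P ↔ ∑ i, ℓ.rep i * w i = 0

/-- The dual curve: the closure of the image of the Gauss map. -/
def dualCurve {K : Type*} [Field K] (V : Set (Plane K)) : Set (Plane K) :=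
  zariskiClosure {ℓ | ∃ P, GaussMap V P ℓ}

/-- Reflexivity of an irreducible plane curve `V` over an algebraically closed field: `V` is equal
to its double dual, and the Gauss map of `V` followed by that of its dual curve is the identity
(as a rational map, that is, wherever it is defined). The dual of a line is a point, which has no
Gauss map; a line counts as reflexive, following the usual convention. -/
def IsReflexive {K : Type*} [Field K] (V : Set (Plane K)) : Prop :=
  (∃ a : Fin 3 → K, a ≠ 0 ∧ V = line a) ∨
    (dualCurve (dualCurve V) = V ∧
      ∀ P ℓ Q : Plane K, GaussMap V P ℓ → GaussMap (dualCurve V) ℓ Q → Q = P)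

/-- The geometric points of the plane curve `F = 0`. -/
def geomPoints {k : Type*} [Field k] (F : MvPolynomial (Fin 3) k) :
    Set (Plane (AlgebraicClosure k)) :=
  {P | MvPolynomial.aeval P.rep F = 0}

/-- The plane curve `F = 0` is smooth: the partial derivatives of `F` have no common zero on the
curve, over the algebraic closure. -/
def IsSmooth {k : Type*} [Field k] (F : MvPolynomial (Fin 3) k) : Prop :=
  ∀ P ∈ geomPoints F, ∃ i, MvPolynomial.aeval P.rep (MvPolynomial.pderiv i F) ≠ 0

/-- The geometric points of the line `a 0 * X + a 1 * Y + a 2 * Z = 0` defined over `k`. -/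
def geomLine {k : Type*} [Field k] (a : Fin 3 → k) : Set (Plane (AlgebraicClosure k)) :=
  line fun i => algebraMap k (AlgebraicClosure k) (a i)

/-- The line with coordinates `a` meets the curve `F = 0` of degree `d` transversely, that is, in
`d` distinct geometric points. -/
def MeetsTransversely {k : Type*} [Field k] (F : MvPolynomial (Fin 3) k) (d : ℕ)
    (a : Fin 3 → k) : Prop :=
  (geomPoints F ∩ geomLine a).encard = d

end PlaneCurve

end

/-!
Suppose that no line over the field `k` with `q` elements is transverse to the smooth curve
`F = 0` of degree `d ≥ 2`. Then each of the `q ^ 2 + q + 1` rational lines `L` is tangent to the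
curve at some point `v`. Consider the form `G = ∑ i, X i ^ q * ∂F/∂X i` of Stöhr and Voloch, of
degree `q + d - 1`, which vanishes at the points of the curve whose tangent line passes through
their Frobenius image. As `L` is rational, it contains the Frobenius image of `v`, so `G` vanishes
at `v`. If `v` is rational, the curves `F = 0` and `G = 0` are even tangent at `v`; otherwise the
Frobenius image of `v` is a second point where `L` is tangent to the curve. Either way, `L`
accounts for an intersection multiplicity of at least `2`, and a point is counted for one line only
(`two_mul_card_le`). If `F` does not divide `G`, Bézout's inequality gives
`2 * (q ^ 2 + q + 1) ≤ d * (q + d - 1)`, which contradicts `d ≤ q + 1`.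

Reflexivity excludes that `F` divides `G` (`not_dvd_frobForm`). If it does, then `∇F(v)` is
orthogonal to `v` and to `v ^ q` for all points `v` of the curve. Since `q`-th powers are constants
for derivations, the derivative of `∇F` along the curve is orthogonal to `v` and `v ^ q` too, so it
is proportional to `∇F(v)`. By biduality, an equation `H` of the dual curve satisfies
`∇H(∇F(v)) ∥ v`, and differentiating this relation along a tangent vector `u` of the curve at a
generic `v` shows that `u` is proportional to `v`, a contradiction.

Bézout's inequality with tangencies (`card_add_card_le_mul`) is proved by comparing the codimension
`d * e` of the ideal `(F, G)` in large degrees (`finrank_multiples_sup`) with the number of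
independent conditions "value at a point" and "derivative at a point in a common tangent
direction". The same codimension shows that two curves always meet (`exists_common_zero`), so that
a smooth plane curve is irreducible (`SmoothForm.irreducible`).
-/

open scoped LinearAlgebra.Projectivization

namespace PlaneCurve

open MvPolynomial

/-! ### Proportional vectors -/

section Par

variable {K : Type*} [Field K]

/-- Two coordinate vectors are proportional, expressed by the vanishing of all `2 × 2` minors. For
nonzero vectors this means that they represent the same point of the plane. -/
def Par (x y : Fin 3 → K) : Prop := ∀ i j, x i * y j = x j * y i

lemma Par.symm {x y : Fin 3 → K} (h : Par x y) : Par y x := fun i j => by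
  rw [mul_comm, h j i, mul_comm]

lemma Par.refl (x : Fin 3 → K) : Par x x := fun _ _ => mul_comm _ _

lemma Par.smul_right {x y : Fin 3 → K} (h : Par x y) (c : K) : Par x (c • y) := fun i j => by
  simp only [Pi.smul_apply, smul_eq_mul]
  linear_combination c * h i j

lemma Par.exists_smul {x y : Fin 3 → K} (h : Par x y) (hx : x ≠ 0) : ∃ c : K, y = c • x := by
  obtain ⟨i, hi⟩ := Function.ne_iff.mp hx
  refine ⟨y i / x i, funext fun j => ?_⟩
  have hi' : x i ≠ 0 := hi
  simp only [Pi.smul_apply, smul_eq_mul]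
  field_simp
  linear_combination h i j

lemma Par.exists_smul_ne {x y : Fin 3 → K} (h : Par x y) (hx : x ≠ 0) (hy : y ≠ 0) :
    ∃ c : K, c ≠ 0 ∧ y = c • x := by
  obtain ⟨c, rfl⟩ := h.exists_smul hx
  exact ⟨c, fun hc => hy (by simp [hc]), rfl⟩

lemma Par.trans {x y z : Fin 3 → K} (h : Par x y) (h' : Par y z) (hy : y ≠ 0) : Par x z := by
  obtain ⟨c, rfl⟩ := h'.exists_smul hy
  exact h.smul_right c

lemma mk_eq_mk_iff_par {x y : Fin 3 → K} (hx : x ≠ 0) (hy : y ≠ 0) :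
    Projectivization.mk K x hx = Projectivization.mk K y hy ↔ Par x y := by
  rw [Projectivization.mk_eq_mk_iff']
  constructor
  · rintro ⟨c, rfl⟩
    exact ((Par.refl y).smul_right c).symm
  · intro h
    obtain ⟨c, hc⟩ := h.symm.exists_smul hy
    exact ⟨c, hc.symm⟩

/-- If two independent linear equations vanish at `x` and `y`, then `x` and `y` are proportional. -/
lemma par_of_dotProduct {a b x y : Fin 3 → K} (hab : ¬ Par a b) (hax : a ⬝ᵥ x = 0)
    (hay : a ⬝ᵥ y = 0) (hbx : b ⬝ᵥ x = 0) (hby : b ⬝ᵥ y = 0) : Par x y := by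
  by_contra hxy
  -- Both `a` and `b` are proportional to the cross product of `x` and `y`.
  let z : Fin 3 → K := ![x 1 * y 2 - x 2 * y 1, x 2 * y 0 - x 0 * y 2, x 0 * y 1 - x 1 * y 0]
  have hz : z ≠ 0 := by
    intro hz
    have h0 := congrFun hz 0
    have h1 := congrFun hz 1
    have h2 := congrFun hz 2
    simp only [z, Matrix.cons_val, Pi.zero_apply] at h0 h1 h2
    apply hxy
    intro i j
    fin_cases i <;> fin_cases j <;> simp
    · linear_combination h2
    · linear_combination -h1
    · linear_combination -h2
    · linear_combination h0
    · linear_combination h1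
    · linear_combination -h0
  have key : ∀ c : Fin 3 → K, c ⬝ᵥ x = 0 → c ⬝ᵥ y = 0 → Par z c := by
    intro c hcx hcy
    simp only [dotProduct, Fin.sum_univ_three] at hcx hcy
    intro i j
    fin_cases i <;> fin_cases j <;> simp [z]
    · linear_combination y 2 * hcx - x 2 * hcy
    · linear_combination -y 1 * hcx + x 1 * hcy
    · linear_combination -y 2 * hcx + x 2 * hcy
    · linear_combination y 0 * hcx - x 0 * hcy
    · linear_combination y 1 * hcx - x 1 * hcy
    · linear_combination -y 0 * hcx + x 0 * hcy
  exact hab ((key a hax hay).symm.trans (key b hbx hby) hz)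

lemma exists_dotProduct_eq_zero_ne {x y : Fin 3 → K} (h : ¬ Par x y) :
    ∃ c : Fin 3 → K, c ⬝ᵥ x = 0 ∧ c ⬝ᵥ y ≠ 0 := by
  simp only [Par, not_forall] at h
  obtain ⟨i, j, hij⟩ := h
  refine ⟨x i • Pi.single j 1 - x j • Pi.single i 1, ?_, ?_⟩
  · simp [sub_dotProduct, smul_dotProduct, mul_comm]
  · simpa [sub_dotProduct, smul_dotProduct, sub_eq_zero] using hij

lemma exists_dotProduct_ne {x : Fin 3 → K} (h : x ≠ 0) : ∃ c : Fin 3 → K, c ⬝ᵥ x ≠ 0 := by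
  obtain ⟨i, hi⟩ := Function.ne_iff.mp h
  exact ⟨Pi.single i 1, by simpa using hi⟩

lemma not_par_ne_zero {x y : Fin 3 → K} (h : ¬ Par x y) : x ≠ 0 := by
  rintro rfl
  exact h fun i j => by simp

/-- A line contains points other than a given one. -/
lemma exists_pair_of_line {a : Fin 3 → K} (ha : a ≠ 0) {x : Fin 3 → K} (hx : x ≠ 0) :
    ∃ y, a ⬝ᵥ y = 0 ∧ ¬ Par x y := by
  by_contra! hcon
  -- otherwise all cross products of `a` with the basis vectors are proportional to `x`
  have h0 := (hcon ![0, a 2, -a 1] (by simp [dotProduct, Fin.sum_univ_three]; ring)).exists_smul hx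
  have h1 := (hcon ![-a 2, 0, a 0] (by simp [dotProduct, Fin.sum_univ_three]; ring)).exists_smul hx
  have h2 := (hcon ![a 1, -a 0, 0] (by simp [dotProduct, Fin.sum_univ_three]; ring)).exists_smul hx
  obtain ⟨c0, h0⟩ := h0
  obtain ⟨c1, h1⟩ := h1
  obtain ⟨c2, h2⟩ := h2
  have e00 := congrFun h0 0
  have e01 := congrFun h0 1
  have e02 := congrFun h0 2
  have e10 := congrFun h1 0
  have e11 := congrFun h1 1
  have e12 := congrFun h1 2
  have e20 := congrFun h2 0
  have e21 := congrFun h2 1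
  have e22 := congrFun h2 2
  simp at e00 e01 e02 e10 e11 e12 e20 e21 e22
  apply ha
  have q0 : a 0 = 0 := by
    rcases e11 with h | h <;> rcases e22 with h' | h' <;> simp_all
  have q1 : a 1 = 0 := by
    rcases e00 with h | h <;> rcases e22 with h' | h' <;> simp_all
  have q2 : a 2 = 0 := by
    rcases e00 with h | h <;> rcases e11 with h' | h' <;> simp_all
  funext i
  fin_cases i <;> assumption

end Par

/-! ### Linear forms, gradients and directional derivatives -/

section Forms

variable {K : Type*} [Field K]

/-- The linear form with coefficient vector `c`. -/
noncomputable def lin (c : Fin 3 → K) : MvPolynomial (Fin 3) K := ∑ i, C (c i) * X i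

@[simp] lemma eval_lin (c v : Fin 3 → K) : eval v (lin c) = c ⬝ᵥ v := by
  simp [lin, dotProduct]

lemma isHomogeneous_lin (c : Fin 3 → K) : (lin c).IsHomogeneous 1 :=
  IsHomogeneous.sum _ _ _ fun i _ => isHomogeneous_C_mul_X _ i

/-- The gradient of the polynomial `A` at the point `v`. -/
noncomputable def grad (A : MvPolynomial (Fin 3) K) (v : Fin 3 → K) : Fin 3 → K :=
  fun i => eval v (pderiv i A)

@[simp] lemma grad_lin (c v : Fin 3 → K) : grad (lin c) v = c := by
  funext i
  simp [grad, lin, pderiv_X, Pi.single_apply]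

@[simp] lemma grad_X (v : Fin 3 → K) (i : Fin 3) :
    grad (X i : MvPolynomial (Fin 3) K) v = Pi.single i 1 := by
  funext j
  simp only [grad, pderiv_X]
  by_cases h : j = i
  · subst h; simp
  · simp [h, Ne.symm h]

lemma grad_mul (A B : MvPolynomial (Fin 3) K) (v : Fin 3 → K) :
    grad (A * B) v = eval v B • grad A v + eval v A • grad B v := by
  funext i
  simp [grad]
  ring

/-- The derivative in the direction `w` at the point `v`. -/
noncomputable def dirDeriv (v w : Fin 3 → K) : MvPolynomial (Fin 3) K →ₗ[K] K where
  toFun A := grad A v ⬝ᵥ w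
  map_add' A B := by simp [grad, dotProduct, add_mul, Finset.sum_add_distrib]
  map_smul' c A := by
    simp [grad, dotProduct, mul_assoc, Finset.mul_sum]

lemma dirDeriv_apply (v w : Fin 3 → K) (A : MvPolynomial (Fin 3) K) :
    dirDeriv v w A = grad A v ⬝ᵥ w := rfl

lemma dirDeriv_mul (v w : Fin 3 → K) (A B : MvPolynomial (Fin 3) K) :
    dirDeriv v w (A * B) = eval v B * dirDeriv v w A + eval v A * dirDeriv v w B := by
  simp [dirDeriv_apply, grad_mul, add_dotProduct]

lemma dirDeriv_X (v w : Fin 3 → K) (i : Fin 3) :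
    dirDeriv v w (X i : MvPolynomial (Fin 3) K) = w i := by
  rw [dirDeriv_apply, grad_X, single_dotProduct, one_mul]

/-- Chain rule for directional derivatives. -/
lemma dirDeriv_bind₁ (v w : Fin 3 → K) (f : Fin 3 → MvPolynomial (Fin 3) K)
    (H : MvPolynomial (Fin 3) K) :
    dirDeriv v w (bind₁ f H) =
      grad H (fun i => eval v (f i)) ⬝ᵥ (fun j => dirDeriv v w (f j)) := by
  induction H using MvPolynomial.induction_on with
  | C a => simp [dirDeriv_apply, grad, dotProduct]
  | add p q hp hq =>
    rw [map_add, map_add, hp, hq, ← add_dotProduct]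
    congr 1
    funext i
    simp [grad]
  | mul_X p i hp =>
    rw [map_mul, dirDeriv_mul, hp, bind₁_X_right, grad_mul, add_dotProduct]
    have h1 : eval v (bind₁ f p) = eval (fun i => eval v (f i)) p := by
      exact eval₂Hom_bind₁ _ _ _ _
    simp [h1]

lemma eval_smul_of_isHomogeneous {n : ℕ} {A : MvPolynomial (Fin 3) K} (hA : A.IsHomogeneous n)
    (c : K) (v : Fin 3 → K) : eval (c • v) A = c ^ n * eval v A := by
  rw [eval_eq, eval_eq, Finset.mul_sum]
  refine Finset.sum_congr rfl fun m hm => ?_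
  have : ∑ i ∈ m.support, m i = n := (hA.degree_eq_sum_deg_support hm).symm
  simp only [Pi.smul_apply, smul_eq_mul, mul_pow, Finset.prod_mul_distrib,
    Finset.prod_pow_eq_pow_sum, this]
  ring

lemma grad_smul_of_isHomogeneous {n : ℕ} {A : MvPolynomial (Fin 3) K} (hA : A.IsHomogeneous n)
    (c : K) (v : Fin 3 → K) : grad A (c • v) = c ^ (n - 1) • grad A v := by
  funext i
  exact eval_smul_of_isHomogeneous hA.pderiv c v

/-- Euler's identity, evaluated at a point. -/
lemma grad_dotProduct_self {n : ℕ} {A : MvPolynomial (Fin 3) K} (hA : A.IsHomogeneous n)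
    (v : Fin 3 → K) : grad A v ⬝ᵥ v = n * eval v A := by
  have h := congrArg (eval v) hA.sum_X_mul_pderiv
  simp only [map_sum, map_mul, eval_X, nsmul_eq_mul, map_natCast] at h
  rw [← h]
  exact Finset.sum_congr rfl fun i _ => mul_comm _ _

lemma lin_ne_zero {c : Fin 3 → K} (hc : c ≠ 0) : lin c ≠ 0 := by
  intro h
  apply hc
  rw [← grad_lin c 0, h]
  funext i
  simp [grad]

end Forms

/-! ### Factors of homogeneous polynomials -/

section Factors

variable {K : Type*} [Field K]

/-- The substitution `X i ↦ X i * T`, under which the homogeneous components of a polynomial become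
the coefficients of a polynomial in `T`. -/
noncomputable def scaleHom (K : Type*) [Field K] :
    MvPolynomial (Fin 3) K →ₐ[K] Polynomial (MvPolynomial (Fin 3) K) :=
  aeval fun i => Polynomial.C (X i) * Polynomial.X

lemma scaleHom_of_isHomogeneous {n : ℕ} {A : MvPolynomial (Fin 3) K} (hA : A.IsHomogeneous n) :
    scaleHom K A = Polynomial.C A * Polynomial.X ^ n := by
  have h1 : ∀ m ∈ A.support, scaleHom K (monomial m (coeff m A)) =
      Polynomial.C (monomial m (coeff m A)) * Polynomial.X ^ n := by
    intro m hm
    have hdeg : ∑ i ∈ m.support, m i = n := (hA.degree_eq_sum_deg_support hm).symm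
    rw [scaleHom, aeval_monomial, Finsupp.prod]
    simp only [mul_pow, Finset.prod_mul_distrib, Finset.prod_pow_eq_pow_sum, hdeg]
    rw [monomial_eq, Finsupp.prod, map_mul, map_prod]
    simp only [map_pow, ← mul_assoc]
    rfl
  conv_lhs => rw [A.as_sum]
  conv_rhs => rw [A.as_sum]
  rw [map_sum, map_sum, Finset.sum_mul]
  exact Finset.sum_congr rfl h1

lemma coeff_scaleHom (A : MvPolynomial (Fin 3) K) (n : ℕ) :
    (scaleHom K A).coeff n = homogeneousComponent n A := by
  conv_lhs => rw [← sum_homogeneousComponent A, map_sum]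
  rw [Polynomial.finsetSum_coeff]
  have h : ∀ i, (scaleHom K (homogeneousComponent i A)).coeff n =
      if n = i then homogeneousComponent i A else 0 := by
    intro i
    rw [scaleHom_of_isHomogeneous (homogeneousComponent_isHomogeneous i A),
      Polynomial.coeff_C_mul_X_pow]
  simp only [h, Finset.sum_ite_eq, Finset.mem_range]
  split_ifs with hn
  · rfl
  · exact (homogeneousComponent_eq_zero _ _ (by omega)).symm

lemma isHomogeneous_of_homogeneousComponent_eq_zero {n : ℕ} {A : MvPolynomial (Fin 3) K}
    (h : ∀ i ≠ n, homogeneousComponent i A = 0) : A.IsHomogeneous n := by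
  have : A = homogeneousComponent n A := by
    conv_lhs => rw [← sum_homogeneousComponent A]
    by_cases hn : n ∈ Finset.range (A.totalDegree + 1)
    · exact Finset.sum_eq_single_of_mem n hn fun i _ hi => h i hi
    · rw [homogeneousComponent_eq_zero n A (by simpa using hn)]
      exact Finset.sum_eq_zero fun i hi => h i fun hin => hn (hin ▸ hi)
  rw [this]
  exact homogeneousComponent_isHomogeneous n A

/-- The factors of a nonzero homogeneous polynomial are homogeneous. -/
lemma exists_isHomogeneous_of_mul {n : ℕ} {A B : MvPolynomial (Fin 3) K} (hAB : A * B ≠ 0)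
    (h : (A * B).IsHomogeneous n) :
    ∃ a b, A.IsHomogeneous a ∧ B.IsHomogeneous b ∧ a + b = n := by
  have hinj : ∀ C : MvPolynomial (Fin 3) K, C ≠ 0 → scaleHom K C ≠ 0 := by
    intro C hC h0
    apply hC
    rw [← sum_homogeneousComponent C]
    refine Finset.sum_eq_zero fun i _ => ?_
    rw [← coeff_scaleHom, h0, Polynomial.coeff_zero]
  have hA0 := left_ne_zero_of_mul hAB
  have hB0 := right_ne_zero_of_mul hAB
  have hA := hinj A hA0
  have hB := hinj B hB0
  -- The image of `A * B` is a monomial in `T`, so the lowest and the highest term agree.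
  have e : scaleHom K A * scaleHom K B = Polynomial.C (A * B) * Polynomial.X ^ n := by
    rw [← map_mul, scaleHom_of_isHomogeneous h]
  have hd : (scaleHom K A).natDegree + (scaleHom K B).natDegree = n := by
    rw [← Polynomial.natDegree_mul hA hB, e, Polynomial.natDegree_C_mul_X_pow _ _ hAB]
  have ht : (scaleHom K A).natTrailingDegree + (scaleHom K B).natTrailingDegree = n := by
    rw [← Polynomial.natTrailingDegree_mul hA hB, e, Polynomial.C_mul_X_pow_eq_monomial,
      Polynomial.natTrailingDegree_monomial hAB]
  have hA1 := Polynomial.natTrailingDegree_le_natDegree (scaleHom K A)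
  have hB1 := Polynomial.natTrailingDegree_le_natDegree (scaleHom K B)
  have hom : ∀ C : MvPolynomial (Fin 3) K,
      (scaleHom K C).natTrailingDegree = (scaleHom K C).natDegree →
      C.IsHomogeneous (scaleHom K C).natDegree := by
    intro C hC
    refine isHomogeneous_of_homogeneousComponent_eq_zero fun i hi => ?_
    rw [← coeff_scaleHom]
    rcases lt_or_gt_of_ne hi with h' | h'
    · exact Polynomial.coeff_eq_zero_of_lt_natTrailingDegree (hC ▸ h')
    · exact Polynomial.coeff_eq_zero_of_natDegree_lt h'
  exact ⟨_, _, hom A (by omega), hom B (by omega), hd⟩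

lemma isHomogeneous_of_mul_left {a m : ℕ} {A B : MvPolynomial (Fin 3) K} (hA0 : A ≠ 0)
    (hA : A.IsHomogeneous a) (h : (A * B).IsHomogeneous (a + m)) : B.IsHomogeneous m := by
  by_cases hB : B = 0
  · rw [hB]
    exact isHomogeneous_zero _ _ _
  · obtain ⟨a', b, hA', hB', hab⟩ := exists_isHomogeneous_of_mul (mul_ne_zero hA0 hB) h
    have := hA.inj_right hA' hA0
    obtain rfl : b = m := by omega
    exact hB'

lemma exists_isHomogeneous_of_dvd {n : ℕ} {A B : MvPolynomial (Fin 3) K} (hB0 : B ≠ 0)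
    (hB : B.IsHomogeneous n) (h : A ∣ B) : ∃ a ≤ n, A.IsHomogeneous a := by
  obtain ⟨C, rfl⟩ := h
  obtain ⟨a, c, ha, -, hac⟩ := exists_isHomogeneous_of_mul hB0 hB
  exact ⟨a, by omega, ha⟩

lemma le_of_dvd_of_isHomogeneous {a n : ℕ} {A B : MvPolynomial (Fin 3) K} (hB0 : B ≠ 0)
    (hA : A.IsHomogeneous a) (hB : B.IsHomogeneous n) (h : A ∣ B) : a ≤ n := by
  obtain ⟨a', ha', hA'⟩ := exists_isHomogeneous_of_dvd hB0 hB h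
  rwa [hA.inj_right hA' (ne_zero_of_dvd_ne_zero hB0 h)]

lemma isUnit_of_isHomogeneous_zero {A : MvPolynomial (Fin 3) K} (hA0 : A ≠ 0)
    (hA : A.IsHomogeneous 0) : IsUnit A := by
  have := totalDegree_eq_zero_iff_eq_C.mp (Nat.le_zero.mp hA.totalDegree_le)
  rw [this] at hA0 ⊢
  exact (IsUnit.mk0 _ fun h => hA0 (by rw [h, C_0])).map C

lemma isUnit_of_dvd_X_pow {A : MvPolynomial (Fin 3) K} {N : ℕ}
    (h : ∀ i, A ∣ (X i : MvPolynomial (Fin 3) K) ^ N) : IsUnit A := by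
  have h01 : IsRelPrime (X 0 : MvPolynomial (Fin 3) K) (X 1) := by
    rw [(X_prime (R := K) (i := (0 : Fin 3))).irreducible.isRelPrime_iff_not_dvd]
    rw [X_dvd_X]
    simp
  exact h01.pow (h 0) (h 1)

lemma homogeneousComponent_mul {a : ℕ} {A : MvPolynomial (Fin 3) K} (hA : A.IsHomogeneous a)
    (s : MvPolynomial (Fin 3) K) (n : ℕ) :
    homogeneousComponent (n + a) (A * s) = A * homogeneousComponent n s := by
  rw [← coeff_scaleHom, ← coeff_scaleHom, map_mul, scaleHom_of_isHomogeneous hA, mul_assoc,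
    Polynomial.coeff_C_mul, mul_comm (Polynomial.X ^ a), Polynomial.coeff_mul_X_pow]

end Factors

/-! ### The Hilbert function of a complete intersection -/

section Hilbert

variable {K : Type*} [Field K]

lemma finrank_homogeneousSubmodule (n : ℕ) :
    2 * Module.finrank K (homogeneousSubmodule (Fin 3) K n) = (n + 1) * (n + 2) := by
  have e : homogeneousSubmodule (Fin 3) K n ≃ₗ[K] ({d : Fin 3 →₀ ℕ | d.degree = n} →₀ K) :=
    (LinearEquiv.ofEq _ _ (homogeneousSubmodule_eq_finsupp_supported (Fin 3) K n)).trans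
      (AddMonoidAlgebra.supportedEquivFinsupp _)
  have hset : {d : Fin 3 →₀ ℕ | d.degree = n} =
      ((Finset.univ.finsuppAntidiag n : Finset (Fin 3 →₀ ℕ)) : Set (Fin 3 →₀ ℕ)) := by
    ext d
    simp [Finset.mem_finsuppAntidiag, Finsupp.degree_eq_sum]
  have hcard : Nat.card {d : Fin 3 →₀ ℕ | d.degree = n} = (n + 2).choose 2 := by
    rw [hset, Nat.card_coe_set_eq, Set.ncard_coe_finset,
      Finset.card_finsuppAntidiag_nat_eq_choose, Finset.card_univ, Fintype.card_fin,
      show 3 + n - 1 = n + 2 by omega, ← Nat.choose_symm (by omega : 2 ≤ n + 2)]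
    simp
  have : Finite {d : Fin 3 →₀ ℕ | d.degree = n} := by
    rw [hset]
    infer_instance
  have := Fintype.ofFinite {d : Fin 3 →₀ ℕ | d.degree = n}
  rw [e.finrank_eq, Module.finrank_finsupp_self, ← Nat.card_eq_fintype_card, hcard,
    Nat.choose_two_right, Nat.mul_div_cancel' (Nat.even_mul_pred_self _).two_dvd]
  simp [mul_comm]

instance (n : ℕ) : Module.Finite K (homogeneousSubmodule (Fin 3) K n) :=
  Module.Finite.iff_fg.mpr (homogeneousSubmodule_fg (Fin 3) K n)

/-- The multiples `A * C` with `C` homogeneous of degree `m`. -/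
noncomputable def multiples (A : MvPolynomial (Fin 3) K) (m : ℕ) :
    Submodule K (MvPolynomial (Fin 3) K) :=
  (homogeneousSubmodule (Fin 3) K m).map (LinearMap.mulLeft K A)

lemma mem_multiples {A B : MvPolynomial (Fin 3) K} {m : ℕ} :
    B ∈ multiples A m ↔ ∃ C : MvPolynomial (Fin 3) K, C.IsHomogeneous m ∧ A * C = B := by
  simp [multiples]

instance (A : MvPolynomial (Fin 3) K) (m : ℕ) : Module.Finite K (multiples A m) := by
  unfold multiples
  infer_instance

lemma finrank_multiples {A : MvPolynomial (Fin 3) K} (hA : A ≠ 0) (m : ℕ) :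
    2 * Module.finrank K (multiples A m) = (m + 1) * (m + 2) := by
  rw [← finrank_homogeneousSubmodule (K := K) m]
  have hinj : Function.Injective (LinearMap.mulLeft K A) := fun x y hxy =>
    mul_left_cancel₀ hA (by simpa using hxy)
  rw [multiples,
    (Submodule.equivMapOfInjective _ hinj (homogeneousSubmodule (Fin 3) K m)).finrank_eq]

/-- In large degrees, the ideal generated by two coprime forms of degrees `a` and `b` has
codimension `a * b`: this is the Koszul resolution. -/
lemma finrank_multiples_sup {a b : ℕ} {A B : MvPolynomial (Fin 3) K} (hA0 : A ≠ 0) (hB0 : B ≠ 0)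
    (hA : A.IsHomogeneous a) (hB : B.IsHomogeneous b) (hAB : IsRelPrime A B) (m : ℕ) :
    Module.finrank K ↥(multiples A (m + b) ⊔ multiples B (m + a)) + a * b =
      Module.finrank K (homogeneousSubmodule (Fin 3) K (m + a + b)) := by
  have hinf : multiples A (m + b) ⊓ multiples B (m + a) = multiples (A * B) m := by
    ext x
    simp only [Submodule.mem_inf, mem_multiples]
    constructor
    · rintro ⟨⟨s, hs, rfl⟩, t, ht, hst⟩
      obtain ⟨u, rfl⟩ : A ∣ t := hAB.dvd_of_dvd_mul_left (Dvd.intro s hst.symm)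
      refine ⟨u, isHomogeneous_of_mul_left hA0 hA (by rwa [add_comm]), ?_⟩
      rw [← hst]
      ring
    · rintro ⟨u, hu, rfl⟩
      refine ⟨⟨B * u, ?_, by ring⟩, A * u, ?_, by ring⟩
      · rw [add_comm]; exact hB.mul hu
      · rw [add_comm]; exact hA.mul hu
  have h := Submodule.finrank_sup_add_finrank_inf_eq (multiples A (m + b)) (multiples B (m + a))
  rw [hinf] at h
  have h1 := finrank_multiples hA0 (m + b)
  have h2 := finrank_multiples hB0 (m + a)
  have h3 := finrank_multiples (mul_ne_zero hA0 hB0) m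
  have h4 := finrank_homogeneousSubmodule (K := K) (m + a + b)
  nlinarith

lemma multiples_sup_le {a b : ℕ} {A B : MvPolynomial (Fin 3) K}
    (hA : A.IsHomogeneous a) (hB : B.IsHomogeneous b) (m : ℕ) :
    multiples A (m + b) ⊔ multiples B (m + a) ≤ homogeneousSubmodule (Fin 3) K (m + a + b) := by
  rw [sup_le_iff]
  constructor
  · intro x hx
    obtain ⟨C, hC, rfl⟩ := mem_multiples.mp hx
    rw [mem_homogeneousSubmodule, show m + a + b = a + (m + b) by ring]
    exact hA.mul hC
  · intro x hx
    obtain ⟨C, hC, rfl⟩ := mem_multiples.mp hx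
    rw [mem_homogeneousSubmodule, show m + a + b = b + (m + a) by ring]
    exact hB.mul hC

end Hilbert

/-! ### Bézout's inequality with tangencies -/

section Bezout

variable {K : Type*} [Field K]

lemma grad_eq_zero_of_sq_dvd {L A : MvPolynomial (Fin 3) K} {v : Fin 3 → K} (hL : eval v L = 0)
    (h : L ^ 2 ∣ A) : grad A v = 0 := by
  obtain ⟨B, rfl⟩ := h
  simp [pow_two, grad_mul, hL]

/-- Interpolation at one of finitely many points: a form of large degree with prescribed value and
prescribed derivative at `v i` which is singular at the other points. -/
lemma exists_interpolating_at {ι : Type*} [Fintype ι] {v : ι → Fin 3 → K} (hv0 : ∀ i, v i ≠ 0)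
    (hv : ∀ i j, i ≠ j → ¬ Par (v i) (v j)) {n : ℕ} (hn : 2 * Fintype.card ι ≤ n) (i : ι)
    (w : Fin 3 → K) (x y : K) :
    ∃ A : MvPolynomial (Fin 3) K, A.IsHomogeneous n ∧ eval (v i) A = x ∧
      (¬ Par (v i) w → dirDeriv (v i) w A = y) ∧
      ∀ j ≠ i, eval (v j) A = 0 ∧ grad A (v j) = 0 := by
  classical
  have hc : ∀ j, ∃ c : Fin 3 → K, j ≠ i → c ⬝ᵥ v j = 0 ∧ c ⬝ᵥ v i ≠ 0 := by
    intro j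
    by_cases h : j = i
    · exact ⟨0, fun h' => absurd h h'⟩
    · obtain ⟨c, hc⟩ := exists_dotProduct_eq_zero_ne (hv j i h)
      exact ⟨c, fun _ => hc⟩
  choose c hc using hc
  obtain ⟨u, hu⟩ := exists_dotProduct_ne (hv0 i)
  set S : MvPolynomial (Fin 3) K := ∏ j ∈ Finset.univ.erase i, lin (c j) ^ 2 with hS
  have hcard : 0 < Fintype.card ι := Fintype.card_pos_iff.mpr ⟨i⟩
  have hSdeg : S.IsHomogeneous (2 * (Fintype.card ι - 1)) := by
    have : ∑ j ∈ Finset.univ.erase i, 1 * 2 = 2 * (Fintype.card ι - 1) := by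
      simp [Finset.card_erase_of_mem, mul_comm]
    rw [← this]
    exact IsHomogeneous.prod _ _ _ fun j _ => (isHomogeneous_lin (c j)).pow 2
  have hSi : eval (v i) S ≠ 0 := by
    rw [hS, map_prod, Finset.prod_ne_zero_iff]
    intro j hj
    rw [map_pow, eval_lin]
    exact pow_ne_zero 2 (hc j (Finset.ne_of_mem_erase hj)).2
  have hdvd : ∀ j ≠ i, lin (c j) ^ 2 ∣ S := fun j hj =>
    Finset.dvd_prod_of_mem _ (Finset.mem_erase.mpr ⟨hj, Finset.mem_univ j⟩)
  have hlin : ∀ j ≠ i, eval (v j) (lin (c j)) = 0 := fun j hj => by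
    rw [eval_lin]; exact (hc j hj).1
  have hzero : ∀ A, S ∣ A → ∀ j ≠ i, eval (v j) A = 0 ∧ grad A (v j) = 0 := by
    intro A hA j hj
    have hj2 := (hdvd j hj).trans hA
    refine ⟨?_, grad_eq_zero_of_sq_dvd (hlin j hj) hj2⟩
    obtain ⟨B, rfl⟩ := (Dvd.intro_left _ (pow_succ _ _).symm : lin (c j) ∣ _).trans hj2
    rw [map_mul, hlin j hj, zero_mul]
  set B := S * lin u ^ (n - 2 * (Fintype.card ι - 1)) with hB
  have hBdeg : B.IsHomogeneous n := by
    have := hSdeg.mul ((isHomogeneous_lin u).pow (n - 2 * (Fintype.card ι - 1)))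
    rwa [one_mul, Nat.add_sub_cancel' (by omega)] at this
  have hBi : eval (v i) B ≠ 0 := by
    rw [hB, map_mul, map_pow, eval_lin]
    exact mul_ne_zero hSi (pow_ne_zero _ hu)
  by_cases hw : Par (v i) w
  · refine ⟨C (x / eval (v i) B) * B, hBdeg.C_mul _, ?_, fun h => absurd hw h, fun j hj => ?_⟩
    · rw [map_mul, eval_C, div_mul_cancel₀ _ hBi]
    · exact hzero _ (Dvd.dvd.mul_left (Dvd.intro _ rfl) _) j hj
  obtain ⟨t, htv, htw⟩ := exists_dotProduct_eq_zero_ne hw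
  set E := S * lin u ^ (n - 2 * (Fintype.card ι - 1) - 1) * lin t with hE
  have hEdeg : E.IsHomogeneous n := by
    have := (hSdeg.mul ((isHomogeneous_lin u).pow (n - 2 * (Fintype.card ι - 1) - 1))).mul
      (isHomogeneous_lin t)
    convert this using 1
    omega
  have hEi : eval (v i) E = 0 := by
    rw [hE, map_mul, eval_lin, htv, mul_zero]
  have hEd : dirDeriv (v i) w E ≠ 0 := by
    rw [hE, dirDeriv_mul, eval_lin, htv, zero_mul, zero_add, dirDeriv_apply (A := lin t), grad_lin,
      map_mul, map_pow, eval_lin]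
    exact mul_ne_zero (mul_ne_zero hSi (pow_ne_zero _ hu)) htw
  set α := x / eval (v i) B with hα
  set β := (y - α * dirDeriv (v i) w B) / dirDeriv (v i) w E with hβ
  refine ⟨C α * B + C β * E, (hBdeg.C_mul _).add (hEdeg.C_mul _), ?_, fun _ => ?_, fun j hj => ?_⟩
  · rw [map_add, map_mul, map_mul (eval (v i)) (C β) E, hEi, eval_C, hα, div_mul_cancel₀ _ hBi]
    ring
  · rw [← smul_eq_C_mul, ← smul_eq_C_mul, map_add, map_smul, map_smul, smul_eq_mul, smul_eq_mul,
      hβ, div_mul_cancel₀ _ hEd]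
    ring
  · refine hzero _ (dvd_add (Dvd.dvd.mul_left (Dvd.intro _ rfl) _) (Dvd.dvd.mul_left ?_ _)) j hj
    exact ⟨_, mul_assoc _ _ _⟩

/-- **Bézout's inequality** in which common points that are also common tangencies count twice: two
coprime forms of degrees `d` and `e` with common zeros `v i` and with a common tangent direction
`w i` at `v i` for `i ∈ D` satisfy `#ι + #D ≤ d * e`. The conditions "value at `v i`" and
"derivative at `v i` along `w i`" are independent on forms of large degree, and vanish on the ideal
generated by the two forms, which has codimension `d * e`. -/
theorem card_add_card_le_mul {ι : Type*} [Fintype ι] {v w : ι → Fin 3 → K} (D : Finset ι)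
    (hv0 : ∀ i, v i ≠ 0) (hv : ∀ i j, i ≠ j → ¬ Par (v i) (v j)) (hw : ∀ i ∈ D, ¬ Par (v i) (w i))
    {d e : ℕ} {F G : MvPolynomial (Fin 3) K} (hF0 : F ≠ 0) (hG0 : G ≠ 0)
    (hF : F.IsHomogeneous d) (hG : G.IsHomogeneous e) (hFG : IsRelPrime F G)
    (hFv : ∀ i, eval (v i) F = 0) (hGv : ∀ i, eval (v i) G = 0)
    (hFw : ∀ i ∈ D, dirDeriv (v i) (w i) F = 0) (hGw : ∀ i ∈ D, dirDeriv (v i) (w i) G = 0) :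
    Fintype.card ι + D.card ≤ d * e := by
  classical
  set m := 2 * Fintype.card ι with hm
  set V := homogeneousSubmodule (Fin 3) K (m + d + e) with hV
  set I := multiples F (m + e) ⊔ multiples G (m + d) with hI
  have hIV : I ≤ V := multiples_sup_le hF hG m
  let Φ : MvPolynomial (Fin 3) K →ₗ[K] (ι → K) × (D → K) :=
    (LinearMap.pi fun i => (aeval (R := K) (v i)).toLinearMap).prod
      (LinearMap.pi fun i : D => dirDeriv (v i) (w i))
  have hΦ1 : ∀ A i, (Φ A).1 i = eval (v i) A := fun A i => rfl
  have hΦ2 : ∀ A (i : D), (Φ A).2 i = dirDeriv (v i) (w i) A := fun A i => rfl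
  have hsurj : Function.Surjective (Φ.domRestrict V) := by
    rintro ⟨x, y⟩
    choose A hA hAx hAy hA0 using fun i => exists_interpolating_at hv0 hv
      (show 2 * Fintype.card ι ≤ m + d + e by omega) i (w i) (x i)
      (if h : i ∈ D then y ⟨i, h⟩ else 0)
    refine ⟨⟨∑ i, A i, IsHomogeneous.sum _ _ _ fun i _ => hA i⟩, Prod.ext ?_ ?_⟩
    · funext i
      rw [LinearMap.domRestrict_apply, hΦ1, map_sum,
        Finset.sum_eq_single_of_mem i (Finset.mem_univ i) fun j _ hj => (hA0 j i hj.symm).1, hAx]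
    · funext i
      rw [LinearMap.domRestrict_apply, hΦ2, map_sum,
        Finset.sum_eq_single_of_mem i.1 (Finset.mem_univ _) fun j _ hj => by
          rw [dirDeriv_apply, (hA0 j i hj.symm).2, zero_dotProduct],
        hAy _ (hw _ i.2), dif_pos i.2]
  have hker : I ≤ LinearMap.ker Φ := by
    have hmul : ∀ (A : MvPolynomial (Fin 3) K) (k : ℕ), (∀ i, eval (v i) A = 0) →
        (∀ i ∈ D, dirDeriv (v i) (w i) A = 0) → multiples A k ≤ LinearMap.ker Φ := by
      intro A k hAv hAw B hB
      obtain ⟨C, -, rfl⟩ := mem_multiples.mp hB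
      rw [LinearMap.mem_ker]
      refine Prod.ext (funext fun i => ?_) (funext fun i => ?_)
      · rw [hΦ1, map_mul, hAv, zero_mul]; rfl
      · rw [hΦ2, dirDeriv_mul, hAv, hAw _ i.2, zero_mul, mul_zero, add_zero]; rfl
    exact sup_le (hmul F _ hFv hFw) (hmul G _ hGv hGw)
  have hrank := LinearMap.finrank_range_add_finrank_ker (Φ.domRestrict V)
  rw [LinearMap.range_eq_top.mpr hsurj, finrank_top, Module.finrank_prod, Module.finrank_pi,
    Module.finrank_pi, Fintype.card_coe] at hrank
  have hle : Module.finrank K I ≤ Module.finrank K (LinearMap.ker (Φ.domRestrict V)) := by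
    let f : I →ₗ[K] LinearMap.ker (Φ.domRestrict V) :=
      (Submodule.inclusion hIV).codRestrict _ fun x => LinearMap.mem_ker.mpr
        (LinearMap.mem_ker.mp (hker x.2))
    refine LinearMap.finrank_le_finrank_of_injective (f := f) fun x y hxy => ?_
    exact Submodule.inclusion_injective hIV (congrArg Subtype.val hxy)
  have hkos := finrank_multiples_sup hF0 hG0 hF hG hFG m
  rw [← hI, ← hV] at hkos
  omega

end Bezout

/-! ### Forms over an algebraically closed field -/

section AlgClosed

variable {K : Type*} [Field K] [IsAlgClosed K]

/-- If some polynomials have no common zero except the origin, a power of each coordinate lies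
in the ideal that they generate. -/
lemma exists_X_pow_mem {S : Set (MvPolynomial (Fin 3) K)}
    (h : ∀ v : Fin 3 → K, (∀ A ∈ S, eval v A = 0) → v = 0) :
    ∃ N : ℕ, ∀ i, (X i : MvPolynomial (Fin 3) K) ^ N ∈ Ideal.span S := by
  have h1 : ∀ i, ∃ N : ℕ, (X i : MvPolynomial (Fin 3) K) ^ N ∈ Ideal.span S := by
    intro i
    have : (X i : MvPolynomial (Fin 3) K) ∈ (Ideal.span S).radical := by
      rw [← vanishingIdeal_zeroLocus_eq_radical (K := K), mem_vanishingIdeal_iff]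
      intro v hv
      rw [zeroLocus_span] at hv
      rw [h v fun A hA => hv A hA]
      simp
    exact this
  choose N hN using h1
  refine ⟨∑ i, N i, fun i => ?_⟩
  exact (Ideal.span S).pow_mem_of_pow_mem (hN i)
    (Finset.single_le_sum (f := N) (fun _ _ => Nat.zero_le _) (Finset.mem_univ i))

/-- Two forms of positive degree have a common zero in the plane. -/
theorem exists_common_zero {a b : ℕ} {A B : MvPolynomial (Fin 3) K} (hA0 : A ≠ 0) (hB0 : B ≠ 0)
    (hA : A.IsHomogeneous a) (hB : B.IsHomogeneous b) (ha : 0 < a) (hb : 0 < b) :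
    ∃ v : Fin 3 → K, v ≠ 0 ∧ eval v A = 0 ∧ eval v B = 0 := by
  by_contra! hcon
  obtain ⟨N, hN⟩ := exists_X_pow_mem (S := {A, B}) fun v hv => by
    by_contra hv0
    exact hcon v hv0 (hv A (by simp)) (hv B (by simp))
  simp only [Ideal.mem_span_pair] at hN
  have hrel : IsRelPrime A B := by
    intro D hDA hDB
    refine isUnit_of_dvd_X_pow (N := N) fun i => ?_
    obtain ⟨s, t, hst⟩ := hN i
    rw [← hst]
    exact dvd_add (hDA.mul_left s) (hDB.mul_left t)
  -- Then all forms of large degree lie in the ideal `(A, B)`, whose codimension is `a * b > 0`.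
  have hle : homogeneousSubmodule (Fin 3) K (3 * N + a + b) ≤
      multiples A (3 * N + b) ⊔ multiples B (3 * N + a) := by
    intro x hx
    have hxI : x ∈ Ideal.span {A, B} := by
      rw [x.as_sum]
      refine Ideal.sum_mem _ fun μ hμ => ?_
      have hdeg : ∑ i ∈ μ.support, μ i = 3 * N + a + b :=
        (IsHomogeneous.degree_eq_sum_deg_support hx hμ).symm
      have hdeg' : μ 0 + μ 1 + μ 2 = 3 * N + a + b := by
        rw [← hdeg, ← Fin.sum_univ_three (fun i => μ i)]
        exact (Finset.sum_subset (Finset.subset_univ _) fun i _ hi => by simpa using hi).symm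
      obtain ⟨i, hi⟩ : ∃ i, N ≤ μ i := by
        by_contra! hlt
        have h0 := hlt 0
        have h1 := hlt 1
        have h2 := hlt 2
        omega
      refine Ideal.mem_of_dvd _ ?_ (Ideal.mem_span_pair.mpr (hN i))
      rw [X_pow_eq_monomial, monomial_dvd_monomial]
      refine ⟨Or.inr (Finsupp.single_le_iff.mpr hi), one_dvd _⟩
    obtain ⟨s, t, rfl⟩ := Ideal.mem_span_pair.mp hxI
    rw [← homogeneousComponent_eq_self hx, map_add, mul_comm s, mul_comm t]
    refine Submodule.add_mem_sup (mem_multiples.mpr ⟨_, homogeneousComponent_isHomogeneous _ s, ?_⟩)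
      (mem_multiples.mpr ⟨_, homogeneousComponent_isHomogeneous _ t, ?_⟩)
    · rw [← homogeneousComponent_mul hA]
      congr 2
      ring
    · rw [← homogeneousComponent_mul hB]
  have h1 := finrank_multiples_sup hA0 hB0 hA hB hrel (3 * N)
  have h2 := Submodule.finrank_mono hle
  have h3 : 0 < a * b := Nat.mul_pos ha hb
  omega

end AlgClosed

/-! ### Smooth forms -/

section Smooth

variable {K : Type*} [Field K]

/-- A form whose zero locus has a well-defined tangent line at each point. -/
def SmoothForm (F : MvPolynomial (Fin 3) K) : Prop :=
  ∀ v : Fin 3 → K, v ≠ 0 → eval v F = 0 → grad F v ≠ 0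

lemma SmoothForm.ne_zero {F : MvPolynomial (Fin 3) K} (hs : SmoothForm F) : F ≠ 0 := by
  rintro rfl
  exact hs 1 one_ne_zero (by simp) (by funext i; simp [grad])

variable [IsAlgClosed K]

/-- A smooth plane curve is irreducible, as two components would meet in a singular point. -/
theorem SmoothForm.irreducible {d : ℕ} {F : MvPolynomial (Fin 3) K} (hs : SmoothForm F)
    (hF : F.IsHomogeneous d) (hd : 1 ≤ d) : Irreducible F := by
  refine ⟨fun hu => ?_, fun {A B} hAB => ?_⟩
  · have := le_of_dvd_of_isHomogeneous one_ne_zero hF (isHomogeneous_one (Fin 3) K) hu.dvd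
    omega
  · subst hAB
    obtain ⟨a, b, hA, hB, -⟩ := exists_isHomogeneous_of_mul hs.ne_zero hF
    have hA0 := left_ne_zero_of_mul hs.ne_zero
    have hB0 := right_ne_zero_of_mul hs.ne_zero
    rcases Nat.eq_zero_or_pos a with rfl | ha
    · exact Or.inl (isUnit_of_isHomogeneous_zero hA0 hA)
    rcases Nat.eq_zero_or_pos b with rfl | hb
    · exact Or.inr (isUnit_of_isHomogeneous_zero hB0 hB)
    obtain ⟨v, hv, hAv, hBv⟩ := exists_common_zero hA0 hB0 hA hB ha hb
    exact absurd (by simp [grad_mul, hAv, hBv]) (hs v hv (by simp [hAv]))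

/-- The Nullstellensatz for an irreducible form. -/
theorem dvd_of_vanishing {d n : ℕ} {F A : MvPolynomial (Fin 3) K} (hirr : Irreducible F)
    (hF : F.IsHomogeneous d) (hA : A.IsHomogeneous n)
    (h : ∀ v : Fin 3 → K, v ≠ 0 → eval v F = 0 → eval v A = 0) : F ∣ A := by
  have hd : 0 < d := by
    rcases Nat.eq_zero_or_pos d with rfl | hd
    · exact absurd (isUnit_of_isHomogeneous_zero hirr.ne_zero hF) hirr.not_isUnit
    · exact hd
  have h0 : eval 0 A = 0 := by
    obtain ⟨v, hv, hFv, -⟩ := exists_common_zero hirr.ne_zero hirr.ne_zero hF hF hd hd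
    rcases Nat.eq_zero_or_pos n with rfl | hn
    · have e := eval_smul_of_isHomogeneous hA 0 v
      rw [zero_smul, h v hv hFv, mul_zero] at e
      exact e
    · have e := eval_smul_of_isHomogeneous hA 0 v
      rw [zero_smul, zero_pow hn.ne', zero_mul] at e
      exact e
  have hprime : (Ideal.span {F}).IsPrime :=
    (Ideal.span_singleton_prime hirr.ne_zero).mpr hirr.prime
  rw [← Ideal.mem_span_singleton, ← IsPrime.vanishingIdeal_zeroLocus (K := K) (Ideal.span {F}),
    mem_vanishingIdeal_iff]
  intro v hv
  have hFv : eval v F = 0 := hv F (Ideal.mem_span_singleton_self F)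
  by_cases hv0 : v = 0
  · rw [hv0]; exact h0
  · exact h v hv0 hFv

end Smooth

/-! ### Lines without tangency are transverse -/

section Transverse

variable {K : Type*} [Field K]

lemma exists_smul_add_smul {a x b v : Fin 3 → K} (ha : a ≠ 0) (hxb : ¬ Par x b) (hax : a ⬝ᵥ x = 0)
    (hab : a ⬝ᵥ b = 0) (hav : a ⬝ᵥ v = 0) : ∃ s t : K, v = s • x + t • b := by
  obtain ⟨c, hcb, hcx⟩ := exists_dotProduct_eq_zero_ne fun h => hxb h.symm
  have hac : ¬ Par a c := fun h => by
    obtain ⟨s, rfl⟩ := h.exists_smul ha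
    exact hcx (by rw [smul_dotProduct, hax, smul_zero])
  have hb0 : b ≠ 0 := not_par_ne_zero fun h => hxb h.symm
  obtain ⟨t, ht⟩ := (par_of_dotProduct (x := b) (y := v - (c ⬝ᵥ v / c ⬝ᵥ x) • x) hac hab
    (by simp [dotProduct_sub, hav, hax]) hcb
    (by rw [dotProduct_sub, dotProduct_smul, smul_eq_mul, div_mul_cancel₀ _ hcx, sub_self])
    ).exists_smul hb0
  exact ⟨_, t, by rw [← ht]; abel⟩

/-- The restriction of `F` to the parametrized line `x + T * y`. -/
noncomputable def restrictLine (x y : Fin 3 → K) (F : MvPolynomial (Fin 3) K) : Polynomial K :=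
  aeval (fun i => Polynomial.C (x i) + Polynomial.C (y i) * Polynomial.X) F

lemma eval_restrictLine (x y : Fin 3 → K) (F : MvPolynomial (Fin 3) K) (t : K) :
    (restrictLine x y F).eval t = eval (x + t • y) F := by
  have := comp_aeval_apply (fun i => Polynomial.C (x i) + Polynomial.C (y i) * Polynomial.X)
    (Polynomial.aeval (R := K) t) F
  rw [restrictLine, ← Polynomial.coe_aeval_eq_eval, this, ← coe_aeval_eq_eval]
  have hpt : (fun i => Polynomial.aeval t
      (Polynomial.C (x i) + Polynomial.C (y i) * Polynomial.X)) = x + t • y := by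
    funext i
    rw [Polynomial.coe_aeval_eq_eval]
    simp only [Polynomial.eval_add, Polynomial.eval_mul, Polynomial.eval_C, Polynomial.eval_X,
      Pi.add_apply, Pi.smul_apply, smul_eq_mul, mul_comm]
  rw [hpt]
  rfl

lemma eval_derivative_restrictLine (x y : Fin 3 → K) (F : MvPolynomial (Fin 3) K) (t : K) :
    (Polynomial.derivative (restrictLine x y F)).eval t = dirDeriv (x + t • y) y F := by
  induction F using MvPolynomial.induction_on with
  | C a => simp [restrictLine, dirDeriv_apply, grad, dotProduct]
  | add p q hp hq => simp only [restrictLine, map_add, Polynomial.eval_add] at hp hq ⊢; rw [hp, hq]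
  | mul_X p i hp =>
    have h1 : restrictLine x y (p * X i) =
        restrictLine x y p * (Polynomial.C (x i) + Polynomial.C (y i) * Polynomial.X) := by
      simp [restrictLine]
    rw [h1, Polynomial.derivative_mul, Polynomial.eval_add, Polynomial.eval_mul,
      Polynomial.eval_mul, hp, eval_restrictLine, dirDeriv_mul, dirDeriv_X]
    simp
    ring

lemma natDegree_restrictLine_le {d : ℕ} {F : MvPolynomial (Fin 3) K} (hF : F.IsHomogeneous d)
    (x y : Fin 3 → K) : (restrictLine x y F).natDegree ≤ d ∧
      (restrictLine x y F).coeff d = eval y F := by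
  have hlin : ∀ i, (Polynomial.C (x i) + Polynomial.C (y i) * Polynomial.X).natDegree ≤ 1 := by
    intro i
    rw [add_comm]
    exact Polynomial.natDegree_linear_le
  have hmon : ∀ m ∈ F.support, (restrictLine x y (monomial m (coeff m F))).natDegree ≤ d ∧
      (restrictLine x y (monomial m (coeff m F))).coeff d = eval y (monomial m (coeff m F)) := by
    intro m hm
    have hdeg : ∑ i ∈ m.support, m i * 1 = d := by
      simpa using (hF.degree_eq_sum_deg_support hm).symm
    have hpow : ∀ i ∈ m.support, ((Polynomial.C (x i) + Polynomial.C (y i) * Polynomial.X) ^ m i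
        ).natDegree ≤ m i * 1 := fun i _ => Polynomial.natDegree_pow_le_of_le _ (hlin i)
    rw [restrictLine, aeval_monomial, eval_monomial, Polynomial.algebraMap_eq, Finsupp.prod,
      Finsupp.prod]
    constructor
    · refine (Polynomial.natDegree_C_mul_le _ _).trans ?_
      rw [← hdeg]
      exact (Polynomial.natDegree_prod_le _ _).trans (Finset.sum_le_sum hpow)
    · have hlead : ∀ s ⊆ m.support,
          (∏ i ∈ s, (Polynomial.C (x i) + Polynomial.C (y i) * Polynomial.X) ^ m i).coeff
            (∑ i ∈ s, m i * 1) = ∏ i ∈ s, y i ^ m i := by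
        intro s
        induction s using Finset.induction_on with
        | empty => simp
        | insert i s his ih =>
          intro hs
          have hs' := (Finset.subset_insert i s).trans hs
          rw [Finset.prod_insert his, Finset.sum_insert his, Finset.prod_insert his,
            Polynomial.coeff_mul_add_eq_of_natDegree_le (hpow i (hs (Finset.mem_insert_self i s)))
              ((Polynomial.natDegree_prod_le _ _).trans
                (Finset.sum_le_sum fun j hj => hpow j (hs' hj))),
            Polynomial.coeff_pow_of_natDegree_le (hlin i), ih hs']
          simp
      rw [Polynomial.coeff_C_mul, ← hdeg, hlead _ subset_rfl]
  have hsum : restrictLine x y F = ∑ m ∈ F.support, restrictLine x y (monomial m (coeff m F)) := by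
    conv_lhs => rw [F.as_sum]
    simp only [restrictLine, map_sum]
  constructor
  · rw [hsum]
    exact Polynomial.natDegree_sum_le_of_forall_le _ _ fun m hm => (hmon m hm).1
  · rw [hsum, Polynomial.finsetSum_coeff, Finset.sum_congr rfl fun m hm => (hmon m hm).2,
      ← map_sum, ← F.as_sum]

variable [IsAlgClosed K]

/-- A line with coordinates `a` at no point of which the gradient of the form `F` of degree `d` is
proportional to `a` meets the curve `F = 0` in `d` distinct points. -/
theorem encard_inter_line {d : ℕ} {F : MvPolynomial (Fin 3) K} (hF : F.IsHomogeneous d)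
    {a : Fin 3 → K} (ha : a ≠ 0)
    (h : ∀ v : Fin 3 → K, v ≠ 0 → eval v F = 0 → a ⬝ᵥ v = 0 → ¬ Par a (grad F v)) :
    ({P : Plane K | eval P.rep F = 0} ∩ line a).encard = d := by
  -- the tangency criterion in terms of the restriction of `F` to the line
  have hcrit : ∀ v w : Fin 3 → K, ¬ Par v w → a ⬝ᵥ v = 0 → a ⬝ᵥ w = 0 → eval v F = 0 →
      dirDeriv v w F ≠ 0 := by
    intro v w hvw hav haw hFv hd
    refine h v (not_par_ne_zero hvw) hFv hav (par_of_dotProduct hvw ?_ ?_ ?_ ?_)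
    · rw [dotProduct_comm, hav]
    · rw [dotProduct_comm, grad_dotProduct_self hF, hFv, mul_zero]
    · rw [dotProduct_comm, haw]
    · rw [dotProduct_comm]
      exact hd
  obtain ⟨x₀, hax₀, hx₀⟩ := exists_pair_of_line ha ha
  have hx₀0 : x₀ ≠ 0 := not_par_ne_zero fun h => hx₀ h.symm
  obtain ⟨y₀, hay₀, hxy₀⟩ := exists_pair_of_line ha hx₀0
  -- a point `b` of the line outside the curve, used as point at infinity
  obtain ⟨b, hb0, hab, hFb⟩ : ∃ b : Fin 3 → K, b ≠ 0 ∧ a ⬝ᵥ b = 0 ∧ eval b F ≠ 0 := by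
    by_contra! hcon
    have hz : restrictLine x₀ y₀ F = 0 := by
      refine Polynomial.funext fun t => ?_
      rw [eval_restrictLine, Polynomial.eval_zero]
      refine hcon _ (fun h0 => hxy₀ ?_) (by simp [dotProduct_add, hax₀, hay₀])
      rw [add_eq_zero_iff_eq_neg, ← neg_smul] at h0
      rw [h0]
      exact ((Par.refl y₀).smul_right _).symm
    refine hcrit x₀ y₀ hxy₀ hax₀ hay₀ (hcon x₀ hx₀0 hax₀) ?_
    have := eval_derivative_restrictLine x₀ y₀ F 0
    rw [hz] at this
    simpa using this.symm
  obtain ⟨x, hax, hbx⟩ := exists_pair_of_line ha hb0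
  have hxb : ¬ Par x b := fun h => hbx h.symm
  obtain ⟨hdeg, hcoeff⟩ := natDegree_restrictLine_le hF x b
  set g := restrictLine x b F with hg
  have hg0 : g ≠ 0 := fun h0 => hFb (by rw [← hcoeff, h0, Polynomial.coeff_zero])
  have hnd : g.natDegree = d :=
    le_antisymm hdeg (Polynomial.le_natDegree_of_ne_zero (by rw [hcoeff]; exact hFb))
  have hpar : ∀ t : K, ¬ Par (x + t • b) b := fun t hp => hxb fun i j => by
    have := hp i j
    simp only [Pi.add_apply, Pi.smul_apply, smul_eq_mul] at this
    linear_combination this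
  have hnodup : g.roots.Nodup := by
    classical
    rw [Multiset.nodup_iff_count_le_one]
    intro t
    rw [Polynomial.count_roots]
    by_contra! hlt
    obtain ⟨hr, hr'⟩ := (Polynomial.one_lt_rootMultiplicity_iff_isRoot hg0).mp hlt
    rw [Polynomial.IsRoot, hg, eval_restrictLine] at hr
    rw [Polynomial.IsRoot, hg, eval_derivative_restrictLine] at hr'
    exact hcrit _ _ (hpar t) (by simp [dotProduct_add, hax, hab]) hab hr hr'
  classical
  have hcard : g.roots.toFinset.card = d := by
    rw [Multiset.toFinset_card_of_nodup hnodup, ← hnd]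
    exact (Polynomial.splits_iff_card_roots.mp (IsAlgClosed.splits g))
  let f : K → Plane K := fun t => Projectivization.mk K (x + t • b) (not_par_ne_zero (hpar t))
  have hinj : Function.Injective f := by
    intro s t hst
    have hp := (mk_eq_mk_iff_par _ _).mp hst
    by_contra hne
    refine hxb fun i j => ?_
    have := hp i j
    simp only [Pi.add_apply, Pi.smul_apply, smul_eq_mul] at this
    have h' : (t - s) * (x i * b j - x j * b i) = 0 := by linear_combination this
    rcases mul_eq_zero.mp h' with h' | h'
    · exact absurd (sub_eq_zero.mp h').symm hne
    · exact sub_eq_zero.mp h'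
  have himage : {P : Plane K | eval P.rep F = 0} ∩ line a = f '' (g.roots.toFinset : Set K) := by
    ext P
    simp only [Set.mem_inter_iff, Set.mem_image, Finset.mem_coe, Multiset.mem_toFinset,
      Polynomial.mem_roots hg0]
    constructor
    · rintro ⟨hPF, hPa⟩
      obtain ⟨s, t, hst⟩ := exists_smul_add_smul ha hxb hax hab hPa
      have hPF' : eval P.rep F = 0 := hPF
      have hs : s ≠ 0 := by
        rintro rfl
        rw [zero_smul, zero_add] at hst
        have ht : t ≠ 0 := fun ht => P.rep_nonzero (by rw [hst, ht, zero_smul])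
        rw [hst, eval_smul_of_isHomogeneous hF] at hPF'
        exact mul_ne_zero (pow_ne_zero _ ht) hFb hPF'
      have hrep : P.rep = s • (x + (t / s) • b) := by
        rw [hst, smul_add, smul_smul, mul_div_cancel₀ _ hs]
      refine ⟨t / s, ?_, ?_⟩
      · rw [hrep, eval_smul_of_isHomogeneous hF] at hPF'
        rw [Polynomial.IsRoot, hg, eval_restrictLine]
        exact (mul_eq_zero.mp hPF').resolve_left (pow_ne_zero _ hs)
      · conv_rhs => rw [← P.mk_rep]
        rw [mk_eq_mk_iff_par, hrep]
        exact (Par.refl _).smul_right s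
    · rintro ⟨t, ht, rfl⟩
      rw [Polynomial.IsRoot, hg, eval_restrictLine] at ht
      obtain ⟨c, hc⟩ := ((mk_eq_mk_iff_par (not_par_ne_zero (hpar t)) (f t).rep_nonzero).mp
        (f t).mk_rep.symm).exists_smul (not_par_ne_zero (hpar t))
      constructor
      · show eval (f t).rep F = 0
        rw [hc, eval_smul_of_isHomogeneous hF, ht, mul_zero]
      · show a ⬝ᵥ (f t).rep = 0
        simp [hc, dotProduct_add, hax, hab]
  rw [himage, hinj.injOn.encard_image, Set.encard_coe_eq_coe_finsetCard, hcard]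

end Transverse

/-! ### Gauss maps and dual curves in terms of equations -/

section Gauss

variable {K : Type*} [Field K]

/-- The points of the plane curve with equation `F`. -/
def curve (F : MvPolynomial (Fin 3) K) : Set (Plane K) := {P | eval P.rep F = 0}

lemma exists_rep_mk {v : Fin 3 → K} (hv : v ≠ 0) :
    ∃ c : K, c ≠ 0 ∧ (Projectivization.mk K v hv).rep = c • v :=
  ((mk_eq_mk_iff_par hv (Projectivization.mk K v hv).rep_nonzero).mp
    (Projectivization.mk K v hv).mk_rep.symm).exists_smul_ne hv (Projectivization.rep_nonzero _)

lemma eval_rep_mk_eq_zero_iff {n : ℕ} {A : MvPolynomial (Fin 3) K} (hA : A.IsHomogeneous n)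
    {v : Fin 3 → K} (hv : v ≠ 0) :
    eval (Projectivization.mk K v hv).rep A = 0 ↔ eval v A = 0 := by
  obtain ⟨c, hc, h⟩ := exists_rep_mk hv
  rw [h, eval_smul_of_isHomogeneous hA, mul_eq_zero, or_iff_right (pow_ne_zero _ hc)]

lemma vanishesOn_zariskiClosure_iff {n : ℕ} {G : MvPolynomial (Fin 3) K} (hG : G.IsHomogeneous n)
    (S : Set (Plane K)) : VanishesOn G (zariskiClosure S) ↔ VanishesOn G S :=
  ⟨fun h P hP => h P fun _ _ _ hA => hA P hP, fun h _ hP => hP n G hG h⟩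

lemma zariskiClosure_empty : zariskiClosure (∅ : Set (Plane K)) = ∅ := by
  refine Set.eq_empty_iff_forall_notMem.mpr fun P hP => ?_
  have := hP 0 1 (isHomogeneous_one _ _) fun Q hQ => absurd hQ (Set.notMem_empty Q)
  simp at this

lemma orthogonal_eq_iff_par {g ℓ : Fin 3 → K} (hℓ : ℓ ≠ 0) :
    (∀ w : Fin 3 → K, g ⬝ᵥ w = 0 ↔ ℓ ⬝ᵥ w = 0) ↔ g ≠ 0 ∧ Par g ℓ := by
  constructor
  · intro h
    refine ⟨?_, ?_⟩
    · rintro rfl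
      obtain ⟨c, hc⟩ := exists_dotProduct_ne hℓ
      exact hc (by rw [dotProduct_comm, ← h, zero_dotProduct])
    · by_contra hp
      obtain ⟨c, hc, hc'⟩ := exists_dotProduct_eq_zero_ne hp
      exact hc' (by rw [dotProduct_comm, ← h, dotProduct_comm, hc])
  · rintro ⟨hg, hp⟩ w
    obtain ⟨c, hc, rfl⟩ := hp.exists_smul_ne hg hℓ
    rw [smul_dotProduct, smul_eq_mul, mul_eq_zero, or_iff_right hc]

/-- The derivative of a multiple of `F` along a tangent direction of the curve `F = 0` vanishes. -/
lemma dirDeriv_eq_zero_of_dvd {F A : MvPolynomial (Fin 3) K} (h : F ∣ A) {v w : Fin 3 → K}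
    (hv : eval v F = 0) (hw : grad F v ⬝ᵥ w = 0) : dirDeriv v w A = 0 := by
  obtain ⟨B, rfl⟩ := h
  rw [dirDeriv_mul, dirDeriv_apply, hw, hv, mul_zero, zero_mul, add_zero]

/-- If the homogeneous ideal of `V` is generated by `F`, the Gauss map of `V` is given by the
gradient of `F` wherever the latter is nonzero, and undefined elsewhere. -/
lemma gaussMap_iff {d : ℕ} {F : MvPolynomial (Fin 3) K} (hF : F.IsHomogeneous d)
    {V : Set (Plane K)}
    (hV : ∀ (n : ℕ) (G : MvPolynomial (Fin 3) K), G.IsHomogeneous n → (VanishesOn G V ↔ F ∣ G))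
    (P ℓ : Plane K) :
    GaussMap V P ℓ ↔ P ∈ V ∧ grad F P.rep ≠ 0 ∧ Par (grad F P.rep) ℓ.rep := by
  have hVF : VanishesOn F V := (hV d F hF).mpr dvd_rfl
  refine and_congr_right fun hP => ?_
  rw [← orthogonal_eq_iff_par ℓ.rep_nonzero]
  refine forall_congr' fun w => ?_
  have : w ∈ tangentSpace V P ↔ grad F P.rep ⬝ᵥ w = 0 := by
    constructor
    · intro hw
      exact hw d F hF hVF
    · intro hw n G hG hGV
      exact dirDeriv_eq_zero_of_dvd ((hV n G hG).mp hGV) (hVF P hP) hw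
  rw [this]
  rfl

/-- The pullback of a polynomial on the dual plane along the Gauss map of the curve `F = 0`. -/
noncomputable def gaussPullback (F : MvPolynomial (Fin 3) K) :
    MvPolynomial (Fin 3) K →ₐ[K] MvPolynomial (Fin 3) K :=
  bind₁ fun i => pderiv i F

lemma eval_gaussPullback (F H : MvPolynomial (Fin 3) K) (v : Fin 3 → K) :
    eval v (gaussPullback F H) = eval (grad F v) H :=
  eval₂Hom_bind₁ _ _ _ _

lemma isHomogeneous_gaussPullback {d n : ℕ} {F H : MvPolynomial (Fin 3) K}
    (hF : F.IsHomogeneous d) (hH : H.IsHomogeneous n) :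
    (gaussPullback F H).IsHomogeneous ((d - 1) * n) :=
  hH.aeval _ fun _ => hF.pderiv

/-- Coprime forms have finitely many common zeros in the plane. -/
lemma finite_common_zeros {a b : ℕ} {A B : MvPolynomial (Fin 3) K} (hA0 : A ≠ 0) (hB0 : B ≠ 0)
    (hA : A.IsHomogeneous a) (hB : B.IsHomogeneous b) (hAB : IsRelPrime A B) :
    (curve A ∩ curve B).Finite := by
  by_contra hinf
  obtain ⟨T, hT, hcard⟩ := Set.Infinite.exists_subset_card_eq hinf (a * b + 1)
  have := card_add_card_le_mul (ι := T) (v := fun P => P.1.rep) (w := fun _ => 0) ∅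
    (fun P => P.1.rep_nonzero) (fun P Q hPQ hpar => hPQ (Subtype.ext (by
      rw [← P.1.mk_rep, ← Q.1.mk_rep, mk_eq_mk_iff_par]
      exact hpar))) (by simp) hA0 hB0 hA hB hAB (fun P => (hT P.2).1) (fun P => (hT P.2).2)
    (by simp) (by simp)
  simp [hcard] at this

/-- An irreducible form of degree at least `2` does not divide a product of nonzero linear forms. -/
lemma not_dvd_prod_lin {d : ℕ} {F : MvPolynomial (Fin 3) K} (hirr : Irreducible F)
    (hF : F.IsHomogeneous d) (hd : 2 ≤ d) {ι : Type*} (s : Finset ι) (c : ι → Fin 3 → K)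
    (hc : ∀ i ∈ s, c i ≠ 0) : ¬ F ∣ ∏ i ∈ s, lin (c i) := by
  intro h
  obtain ⟨i, hi, hdvd⟩ := (hirr.prime.dvd_finsetProd_iff _).mp h
  have := le_of_dvd_of_isHomogeneous (lin_ne_zero (hc i hi)) hF (isHomogeneous_lin _) hdvd
  omega

variable [IsAlgClosed K]

lemma vanishesOn_curve_iff {d n : ℕ} {F G : MvPolynomial (Fin 3) K} (hirr : Irreducible F)
    (hF : F.IsHomogeneous d) (hG : G.IsHomogeneous n) : VanishesOn G (curve F) ↔ F ∣ G := by
  constructor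
  · intro h
    refine dvd_of_vanishing hirr hF hG fun v hv hFv => ?_
    rw [← eval_rep_mk_eq_zero_iff hG hv]
    exact h _ ((eval_rep_mk_eq_zero_iff hF hv).mpr hFv)
  · rintro ⟨A, rfl⟩ P hP
    rw [map_mul, show eval P.rep F = 0 from hP, zero_mul]

lemma curve_nonempty {d : ℕ} {F : MvPolynomial (Fin 3) K} (hF0 : F ≠ 0) (hF : F.IsHomogeneous d)
    (hd : 1 ≤ d) : (curve F).Nonempty := by
  obtain ⟨v, hv, hFv, -⟩ := exists_common_zero hF0 hF0 hF hF hd hd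
  exact ⟨_, (eval_rep_mk_eq_zero_iff hF hv).mpr hFv⟩

/-- A form vanishes on the dual of a smooth curve if and only if its pullback along the Gauss map
vanishes on the curve. -/
lemma vanishesOn_dualCurve_iff {d n : ℕ} {F H : MvPolynomial (Fin 3) K} (hs : SmoothForm F)
    (hF : F.IsHomogeneous d) (hd : 1 ≤ d) (hH : H.IsHomogeneous n) :
    VanishesOn H (dualCurve (curve F)) ↔ F ∣ gaussPullback F H := by
  have hirr := hs.irreducible hF hd
  have hgauss := gaussMap_iff hF fun n G hG => vanishesOn_curve_iff hirr hF hG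
  rw [dualCurve, vanishesOn_zariskiClosure_iff hH,
    ← vanishesOn_curve_iff hirr hF (isHomogeneous_gaussPullback hF hH)]
  constructor
  · intro h P hP
    have hg : grad F P.rep ≠ 0 := hs _ P.rep_nonzero hP
    rw [eval_gaussPullback, ← eval_rep_mk_eq_zero_iff hH hg]
    refine h _ ⟨P, (hgauss P _).mpr ⟨hP, hg, ?_⟩⟩
    obtain ⟨c, -, hc⟩ := exists_rep_mk hg
    rw [hc]
    exact (Par.refl _).smul_right c
  · rintro h ℓ ⟨P, hP⟩
    obtain ⟨hPV, hg, hpar⟩ := (hgauss P ℓ).mp hP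
    obtain ⟨c, hc⟩ := hpar.exists_smul hg
    have := h P hPV
    rw [eval_gaussPullback] at this
    rw [hc, eval_smul_of_isHomogeneous hH, this, mul_zero]

/-- The dual of a smooth curve of degree at least `2` is cut out by any irreducible form that
vanishes on it: otherwise two coprime forms would vanish on it, so the Gauss map would have
finite image, and the curve would be contained in finitely many of its tangent lines. -/
lemma dvd_of_vanishesOn_dualCurve {d n m : ℕ} {F H G : MvPolynomial (Fin 3) K}
    (hs : SmoothForm F) (hF : F.IsHomogeneous d) (hd : 2 ≤ d) (hirr : Irreducible H)
    (hH : H.IsHomogeneous n) (hHV : F ∣ gaussPullback F H) (hG : G.IsHomogeneous m)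
    (hGV : F ∣ gaussPullback F G) : H ∣ G := by
  by_cases hG0 : G = 0
  · rw [hG0]; exact dvd_zero _
  by_contra hnot
  have hfin := finite_common_zeros hirr.ne_zero hG0 hH hG (hirr.isRelPrime_iff_not_dvd.mpr hnot)
  have hFirr := hs.irreducible hF (by omega)
  refine not_dvd_prod_lin hFirr hF hd hfin.toFinset (fun ℓ => ℓ.rep) (fun ℓ _ => ℓ.rep_nonzero)
    (dvd_of_vanishing hFirr hF (IsHomogeneous.prod _ _ _ fun ℓ _ => isHomogeneous_lin ℓ.rep)
      fun v hv hFv => ?_)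
  have hpull : ∀ A, F ∣ gaussPullback F A → eval (grad F v) A = 0 := by
    rintro A ⟨B, hB⟩
    rw [← eval_gaussPullback, hB, map_mul, hFv, zero_mul]
  have hg := hs v hv hFv
  obtain ⟨c, -, hc⟩ := exists_rep_mk hg
  rw [map_prod]
  refine Finset.prod_eq_zero (i := Projectivization.mk K _ hg) ?_ ?_
  · rw [Set.Finite.mem_toFinset]
    exact ⟨(eval_rep_mk_eq_zero_iff hH hg).mpr (hpull H hHV),
      (eval_rep_mk_eq_zero_iff hG hg).mpr (hpull G hGV)⟩
  · rw [eval_lin, hc, smul_dotProduct, grad_dotProduct_self hF, hFv, mul_zero, smul_zero]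

end Gauss

/-! ### Reflexive curves are Frobenius classical -/

section Frobenius

variable {K : Type*} [Field K]

/-- The form of Stöhr and Voloch, which vanishes at a point of the curve `F = 0` if and only if the
tangent line there passes through the image of the point under the `q`-power Frobenius map. -/
noncomputable def frobForm (q : ℕ) (F : MvPolynomial (Fin 3) K) : MvPolynomial (Fin 3) K :=
  ∑ i, X i ^ q * pderiv i F

lemma isHomogeneous_frobForm {d : ℕ} {F : MvPolynomial (Fin 3) K} (hF : F.IsHomogeneous d)
    (q : ℕ) : (frobForm q F).IsHomogeneous (q + (d - 1)) :=
  IsHomogeneous.sum _ _ _ fun i _ => (isHomogeneous_X_pow i q).mul hF.pderiv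

lemma eval_frobForm (q : ℕ) (F : MvPolynomial (Fin 3) K) (v : Fin 3 → K) :
    eval v (frobForm q F) = v ^ q ⬝ᵥ grad F v := by
  simp [frobForm, dotProduct, grad]

/-- The derivative of the gradient of `F` at `v` in the direction `w`, that is, the product of
the Hessian matrix with `w`. -/
noncomputable def hess (F : MvPolynomial (Fin 3) K) (v w : Fin 3 → K) : Fin 3 → K :=
  fun i => dirDeriv v w (pderiv i F)

lemma dirDeriv_gaussPullback (F H : MvPolynomial (Fin 3) K) (v w : Fin 3 → K) :
    dirDeriv v w (gaussPullback F H) = grad H (grad F v) ⬝ᵥ hess F v w :=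
  dirDeriv_bind₁ v w _ H

/-- As the `q`-th powers are constants for derivations, only the gradient is differentiated. -/
lemma dirDeriv_frobForm {q : ℕ} (hq : (q : K) = 0) (F : MvPolynomial (Fin 3) K)
    (v w : Fin 3 → K) : dirDeriv v w (frobForm q F) = v ^ q ⬝ᵥ hess F v w := by
  have h : ∀ i, dirDeriv v w ((X i : MvPolynomial (Fin 3) K) ^ q) = 0 := by
    intro i
    rw [dirDeriv_apply]
    have : grad ((X i : MvPolynomial (Fin 3) K) ^ q) v = 0 := by
      funext j
      simp [grad, hq]
    rw [this, zero_dotProduct]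
  simp [frobForm, map_sum, dirDeriv_mul, h, dotProduct, hess]

lemma dotProduct_hess {d : ℕ} {F : MvPolynomial (Fin 3) K} (hF : F.IsHomogeneous d)
    {v w : Fin 3 → K} (hw : grad F v ⬝ᵥ w = 0) : v ⬝ᵥ hess F v w = 0 := by
  have h := congrArg (dirDeriv v w) hF.sum_X_mul_pderiv
  rw [map_nsmul, dirDeriv_apply (A := F), hw, smul_zero, map_sum] at h
  simp only [dirDeriv_mul, dirDeriv_X, eval_X, Finset.sum_add_distrib] at h
  have h' : ∑ i, eval v (pderiv i F) * w i = 0 := hw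
  rw [h', zero_add] at h
  exact h

variable [IsAlgClosed K]

/-- The homogeneous ideal of the dual of a curve that equals its double dual is generated by one
form `H`, and the gradient of `H` does not vanish identically on the dual curve. As the double dual
is not empty, the dual curve has a smooth point, so some form vanishing on the dual curve has
nonzero gradient there; `H` is an irreducible factor of that form. -/
lemma exists_dual_equation {d : ℕ} {F : MvPolynomial (Fin 3) K}
    (hs : SmoothForm F) (hF : F.IsHomogeneous d) (hd : 2 ≤ d)
    (hdual : dualCurve (dualCurve (curve F)) = curve F) :
    ∃ (n : ℕ) (H : MvPolynomial (Fin 3) K), H.IsHomogeneous n ∧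
      (∀ (m : ℕ) (G : MvPolynomial (Fin 3) K), G.IsHomogeneous m →
        (VanishesOn G (dualCurve (curve F)) ↔ H ∣ G)) ∧
      ∃ j, ¬ F ∣ gaussPullback F (pderiv j H) := by
  have hirr := hs.irreducible hF (by omega)
  have hstar := fun (n : ℕ) (H : MvPolynomial (Fin 3) K) (hH : H.IsHomogeneous n) =>
    vanishesOn_dualCurve_iff hs hF (by omega) hH
  obtain ⟨ℓ₀, Q₀, hℓ₀⟩ : ∃ ℓ₀ Q₀, GaussMap (dualCurve (curve F)) ℓ₀ Q₀ := by
    by_contra! hcon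
    have hempty : {ℓ | ∃ P, GaussMap (dualCurve (curve F)) P ℓ} = ∅ :=
      Set.eq_empty_iff_forall_notMem.mpr fun ℓ ⟨P, hP⟩ => hcon P ℓ hP
    obtain ⟨P, hP⟩ := curve_nonempty hs.ne_zero hF (by omega)
    rw [← hdual, dualCurve, hempty, zariskiClosure_empty] at hP
    exact hP
  obtain ⟨n₀, H₀, hH₀, hH₀V, hH₀grad⟩ : ∃ (n : ℕ) (H : MvPolynomial (Fin 3) K),
      H.IsHomogeneous n ∧ VanishesOn H (dualCurve (curve F)) ∧ grad H ℓ₀.rep ≠ 0 := by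
    by_contra! hcon
    obtain ⟨w, hw⟩ := exists_dotProduct_ne Q₀.rep_nonzero
    refine hw ?_
    rw [dotProduct_comm]
    refine (hℓ₀.2 w).mp fun n G hG hGV => ?_
    have : grad G ℓ₀.rep ⬝ᵥ w = 0 := by rw [hcon n G hG hGV, zero_dotProduct]
    exact this
  have hH₀0 : H₀ ≠ 0 := by
    rintro rfl
    exact hH₀grad (by funext i; simp [grad])
  obtain ⟨H, hHirr, hHV', C, hC⟩ : ∃ H, Irreducible H ∧ F ∣ gaussPullback F H ∧ H ∣ H₀ := by
    obtain ⟨f, hf, hprod⟩ := UniqueFactorizationMonoid.exists_prime_factors H₀ hH₀0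
    have hdvd : F ∣ gaussPullback F f.prod :=
      ((hstar n₀ H₀ hH₀).mp hH₀V).trans (map_dvd (gaussPullback F) hprod.symm.dvd)
    rw [map_multiset_prod] at hdvd
    obtain ⟨H, hHf, hH⟩ := hirr.prime.exists_mem_multiset_map_dvd hdvd
    exact ⟨H, (hf H hHf).irreducible, hH, (Multiset.dvd_prod hHf).trans hprod.dvd⟩
  obtain ⟨n, -, hH⟩ := exists_isHomogeneous_of_dvd hH₀0 hH₀ ⟨C, hC⟩
  have hHV : VanishesOn H (dualCurve (curve F)) := (hstar n H hH).mpr hHV'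
  have hHgrad : grad H ℓ₀.rep ≠ 0 := by
    intro h0
    apply hH₀grad
    rw [hC, grad_mul, h0, hHV ℓ₀ hℓ₀.1, smul_zero, zero_smul, add_zero]
  refine ⟨n, H, hH, fun m G hG => ⟨fun h => ?_, ?_⟩, ?_⟩
  · exact dvd_of_vanishesOn_dualCurve hs hF hd hHirr hH hHV' hG ((hstar m G hG).mp h)
  · rintro ⟨A, rfl⟩ P hP
    rw [map_mul, hHV P hP, zero_mul]
  · by_contra! hcon
    refine hHgrad (funext fun j => ?_)
    have hj : VanishesOn (pderiv j H) (dualCurve (curve F)) :=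
      (hstar (n - 1) (pderiv j H) hH.pderiv).mpr (hcon j)
    exact hj ℓ₀ hℓ₀.1

/-- If the Gauss map of the dual curve inverts the Gauss map of `F = 0`, then the gradient of an
equation `H` of the dual curve inverts the gradient of `F`. -/
lemma par_grad_grad {d n : ℕ} {F H : MvPolynomial (Fin 3) K}
    (hs : SmoothForm F) (hF : F.IsHomogeneous d) (hd : 1 ≤ d) (hH : H.IsHomogeneous n)
    (hHV : ∀ (m : ℕ) (G : MvPolynomial (Fin 3) K), G.IsHomogeneous m →
        (VanishesOn G (dualCurve (curve F)) ↔ H ∣ G))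
    (hrefl : ∀ P ℓ Q : Plane K, GaussMap (curve F) P ℓ → GaussMap (dualCurve (curve F)) ℓ Q →
      Q = P) {v : Fin 3 → K} (hv : v ≠ 0) (hFv : eval v F = 0) :
    Par (grad H (grad F v)) v := by
  by_cases h0 : grad H (grad F v) = 0
  · rw [h0]
    exact fun i j => by simp
  have hirr := hs.irreducible hF hd
  have hg := hs v hv hFv
  obtain ⟨c, hc0, hc⟩ := exists_rep_mk hv
  obtain ⟨c', hc0', hc'⟩ := exists_rep_mk hg
  obtain ⟨c'', hc0'', hc''⟩ := exists_rep_mk h0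
  have h1 : GaussMap (curve F) (Projectivization.mk K v hv) (Projectivization.mk K _ hg) := by
    refine (gaussMap_iff hF (fun n G hG => vanishesOn_curve_iff hirr hF hG) _ _).mpr
      ⟨(eval_rep_mk_eq_zero_iff hF hv).mpr hFv, ?_, ?_⟩
    · rw [hc, grad_smul_of_isHomogeneous hF]
      exact smul_ne_zero (pow_ne_zero _ hc0) hg
    · rw [hc, hc', grad_smul_of_isHomogeneous hF]
      exact (((Par.refl _).smul_right _).symm).smul_right _
  have h2 : GaussMap (dualCurve (curve F)) (Projectivization.mk K _ hg)
      (Projectivization.mk K _ h0) := by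
    refine (gaussMap_iff hH hHV _ _).mpr ⟨?_, ?_, ?_⟩
    · exact fun _ _ _ hG => hG _ ⟨_, h1⟩
    · rw [hc', grad_smul_of_isHomogeneous hH]
      exact smul_ne_zero (pow_ne_zero _ hc0') h0
    · rw [hc', hc'', grad_smul_of_isHomogeneous hH]
      exact (((Par.refl _).smul_right _).symm).smul_right _
  exact (mk_eq_mk_iff_par h0 hv).mp (hrefl _ _ _ h1 h2)

/-- A form that does not vanish on an irreducible curve of degree at least `2` is nonzero at some
point of the curve that is not fixed by the `q`-power Frobenius map. Indeed the fixed points lie on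
finitely many lines, `X 0 = 0` and `X 1 = r * X 0` with `r ^ q = r`. -/
lemma exists_not_par_pow {d n q : ℕ} (hq : q ≠ 1) {F A : MvPolynomial (Fin 3) K}
    (hirr : Irreducible F) (hF : F.IsHomogeneous d) (hd : 2 ≤ d) (hA : A.IsHomogeneous n)
    (hFA : ¬ F ∣ A) :
    ∃ v : Fin 3 → K, v ≠ 0 ∧ eval v F = 0 ∧ ¬ Par v (v ^ q) ∧ eval v A ≠ 0 := by
  classical
  by_contra! hcon
  have hpoly : (Polynomial.X ^ q - Polynomial.X : Polynomial K) ≠ 0 := by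
    intro h0
    have := congrArg (fun p => Polynomial.coeff p 1) h0
    simp [Polynomial.coeff_X_pow, Ne.symm hq] at this
  set R := (Polynomial.X ^ q - Polynomial.X : Polynomial K).roots.toFinset with hR
  let c : Option K → Fin 3 → K := fun r => r.elim ![1, 0, 0] fun r => ![-r, 1, 0]
  have hc : ∀ r ∈ Finset.insertNone R, c r ≠ 0 := by
    intro r _ h0
    cases r with
    | none => simpa [c] using congrFun h0 0
    | some r => simpa [c] using congrFun h0 1
  have hdvd : F ∣ A * ∏ r ∈ Finset.insertNone R, lin (c r) := by
    refine dvd_of_vanishing hirr hF (hA.mul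
      (IsHomogeneous.prod _ _ _ fun r _ => isHomogeneous_lin (c r))) fun v hv hFv => ?_
    rw [map_mul, map_prod]
    by_cases hvq : Par v (v ^ q)
    · refine mul_eq_zero_of_right _ ?_
      by_cases h0 : v 0 = 0
      · refine Finset.prod_eq_zero (i := none) (by simp) ?_
        simp [c, dotProduct, Fin.sum_univ_three, h0]
      · refine Finset.prod_eq_zero (i := some (v 1 / v 0)) ?_ ?_
        · rw [Finset.some_mem_insertNone, hR, Multiset.mem_toFinset, Polynomial.mem_roots hpoly]
          have h01 : v 0 * v 1 ^ q = v 1 * v 0 ^ q := hvq 0 1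
          simp only [Polynomial.IsRoot, Polynomial.eval_sub, Polynomial.eval_pow,
            Polynomial.eval_X, div_pow]
          field_simp
          linear_combination h01
        · simp [c, dotProduct, Fin.sum_univ_three, h0]
    · exact mul_eq_zero_of_left (hcon v hv hFv hvq) _
  rcases hirr.prime.dvd_or_dvd hdvd with h | h
  · exact hFA h
  · exact not_dvd_prod_lin hirr hF hd _ c hc h

/-- A smooth curve of degree at least `2` whose double dual is the curve itself, with biduality of
Gauss maps, is not Frobenius nonclassical: the tangent line at the generic point `v` does not pass
through the Frobenius image of `v`. Otherwise, differentiating the equations `v ⬝ ∇F = 0` and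
`v ^ q ⬝ ∇F = 0` along the curve, the derivative of the Gauss map at `v` is orthogonal to `v` and
`v ^ q`, hence proportional to `∇F`. So the Gauss map has derivative zero as a map of curves, which
is impossible for a map with a rational inverse. -/
theorem not_dvd_frobForm {d q : ℕ} (hq : (q : K) = 0) {F : MvPolynomial (Fin 3) K}
    (hs : SmoothForm F) (hF : F.IsHomogeneous d) (hd : 2 ≤ d)
    (hdual : dualCurve (dualCurve (curve F)) = curve F)
    (hrefl : ∀ P ℓ Q : Plane K, GaussMap (curve F) P ℓ → GaussMap (dualCurve (curve F)) ℓ Q →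
      Q = P) : ¬ F ∣ frobForm q F := by
  intro hfrob
  have hirr := hs.irreducible hF (by omega)
  have hq1 : q ≠ 1 := by
    rintro rfl
    simp at hq
  obtain ⟨n, H, hH, hHV, j, hj⟩ := exists_dual_equation hs hF hd hdual
  have hinv : ∀ v : Fin 3 → K, v ≠ 0 → eval v F = 0 → Par (grad H (grad F v)) v :=
    fun v hv hFv => par_grad_grad hs hF (by omega) hH hHV hrefl hv hFv
  obtain ⟨v, hv, hFv, hvq, hHv⟩ := exists_not_par_pow hq1 hirr hF hd
    (isHomogeneous_gaussPullback hF hH.pderiv) hj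
  have hHv0 : grad H (grad F v) ≠ 0 := fun h0 => hHv (by
    rw [eval_gaussPullback]
    exact congrFun h0 j)
  have hg := hs v hv hFv
  have hgv : grad F v ⬝ᵥ v = 0 := by rw [grad_dotProduct_self hF, hFv, mul_zero]
  obtain ⟨u, hgu, hvu⟩ := exists_pair_of_line hg hv
  -- The derivative of the Gauss map is proportional to the Gauss map itself.
  obtain ⟨μ, hμ⟩ : ∃ μ : K, hess F v u = μ • grad F v := by
    refine Par.exists_smul (par_of_dotProduct hvq ?_ (dotProduct_hess hF hgu) ?_ ?_) hg
    · rw [dotProduct_comm, hgv]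
    · obtain ⟨B, hB⟩ := hfrob
      rw [← eval_frobForm, hB, map_mul, hFv, zero_mul]
    · rw [← dirDeriv_frobForm hq, dirDeriv_eq_zero_of_dvd hfrob hFv hgu]
  -- Differentiating `∇H(∇F(v)) ∥ v` along `u` now gives `∇H(∇F(v)) ∥ u`.
  have hu : Par (grad H (grad F v)) u := by
    intro i j
    have hdvd : F ∣ gaussPullback F (pderiv i H) * X j - gaussPullback F (pderiv j H) * X i := by
      refine dvd_of_vanishing hirr hF (((isHomogeneous_gaussPullback hF hH.pderiv).mul
        (isHomogeneous_X K j)).sub ((isHomogeneous_gaussPullback hF hH.pderiv).mul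
        (isHomogeneous_X K i))) fun v hv hFv => ?_
      rw [map_sub, map_mul, map_mul, eval_gaussPullback, eval_gaussPullback, eval_X, eval_X,
        mul_comm _ (v j), mul_comm _ (v i), sub_eq_zero, mul_comm (v j), mul_comm (v i)]
      exact hinv v hv hFv i j
    have h := dirDeriv_eq_zero_of_dvd hdvd hFv hgu
    rw [map_sub, dirDeriv_mul, dirDeriv_mul, dirDeriv_X, dirDeriv_X, dirDeriv_gaussPullback,
      dirDeriv_gaussPullback, hμ, dotProduct_smul, dotProduct_smul,
      grad_dotProduct_self hH.pderiv, grad_dotProduct_self hH.pderiv, eval_gaussPullback,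
      eval_gaussPullback, eval_X, eval_X] at h
    have h' := hinv v hv hFv i j
    simp only [grad, smul_eq_mul] at h h' ⊢
    linear_combination h - μ * ((n - 1 : ℕ) : K) * h'
  exact hvu ((hinv v hv hFv).symm.trans hu hHv0)

end Frobenius

/-! ### Counting rational lines that are not transverse -/

section Counting

variable {k : Type*} [Field k]

/-- The equation of the curve `F = 0` over the algebraic closure. -/
noncomputable def geomForm (F : MvPolynomial (Fin 3) k) :
    MvPolynomial (Fin 3) (AlgebraicClosure k) :=
  map (algebraMap k (AlgebraicClosure k)) F

/-- A coordinate vector over `k`, regarded over the algebraic closure. -/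
noncomputable def baseChange (a : Fin 3 → k) : Fin 3 → AlgebraicClosure k :=
  fun i => algebraMap k (AlgebraicClosure k) (a i)

lemma baseChange_ne_zero {a : Fin 3 → k} (ha : a ≠ 0) : baseChange a ≠ 0 := by
  obtain ⟨i, hi⟩ := Function.ne_iff.mp ha
  intro h
  exact hi (by simpa [baseChange] using congrFun h i)

lemma par_of_par_baseChange {a b : Fin 3 → k} (h : Par (baseChange a) (baseChange b)) :
    Par a b := by
  intro i j
  have := h i j
  simp only [baseChange, ← map_mul] at this
  exact (algebraMap k (AlgebraicClosure k)).injective this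

lemma eval_geomForm (F : MvPolynomial (Fin 3) k) (v : Fin 3 → AlgebraicClosure k) :
    eval v (geomForm F) = aeval v F := by
  rw [geomForm, eval_map, aeval_def]

lemma grad_geomForm (F : MvPolynomial (Fin 3) k) (v : Fin 3 → AlgebraicClosure k) :
    grad (geomForm F) v = fun i => aeval v (pderiv i F) := by
  funext i
  rw [grad, geomForm, pderiv_map, eval_map, aeval_def]

lemma geomPoints_eq_curve (F : MvPolynomial (Fin 3) k) : geomPoints F = curve (geomForm F) := by
  ext P
  show aeval P.rep F = 0 ↔ eval P.rep (geomForm F) = 0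
  rw [eval_geomForm]

lemma isHomogeneous_geomForm {d : ℕ} {F : MvPolynomial (Fin 3) k} (hF : F.IsHomogeneous d) :
    (geomForm F).IsHomogeneous d := hF.map _

lemma IsSmooth.smoothForm {d : ℕ} {F : MvPolynomial (Fin 3) k} (hF : F.IsHomogeneous d)
    (hs : IsSmooth F) : SmoothForm (geomForm F) := by
  intro v hv hFv h0
  obtain ⟨c, -, hc⟩ := exists_rep_mk hv
  obtain ⟨i, hi⟩ := hs (Projectivization.mk _ v hv) (by
    rw [geomPoints_eq_curve]
    exact (eval_rep_mk_eq_zero_iff (isHomogeneous_geomForm hF) hv).mpr hFv)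
  apply hi
  have := congrFun (grad_smul_of_isHomogeneous (isHomogeneous_geomForm hF) c v) i
  rw [← hc, h0, grad_geomForm] at this
  simpa using this

/-- A rational line that does not meet a curve transversely is the tangent line at some point. -/
lemma exists_tangent_of_not_meetsTransversely {d : ℕ} {F : MvPolynomial (Fin 3) k}
    (hF : F.IsHomogeneous d) {a : Fin 3 → k} (ha : a ≠ 0) (h : ¬ MeetsTransversely F d a) :
    ∃ v, v ≠ 0 ∧ eval v (geomForm F) = 0 ∧ baseChange a ⬝ᵥ v = 0 ∧
      Par (baseChange a) (grad (geomForm F) v) := by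
  by_contra! hcon
  apply h
  rw [MeetsTransversely, geomPoints_eq_curve]
  exact encard_inter_line (isHomogeneous_geomForm hF) (baseChange_ne_zero ha) hcon

/-- A smooth curve of degree `1` is met transversely by every other line, in particular by one of
the coordinate axes. -/
lemma exists_meetsTransversely_of_degree_one {F : MvPolynomial (Fin 3) k}
    (hF : F.IsHomogeneous 1) (hs : IsSmooth F) :
    ∃ a : Fin 3 → k, a ≠ 0 ∧ MeetsTransversely F 1 a := by
  have hFK := isHomogeneous_geomForm hF
  have hsK := hs.smoothForm hF
  have hconst : ∀ i, ∃ e : k, pderiv i F = C e := fun i =>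
    ⟨_, totalDegree_eq_zero_iff_eq_C.mp (Nat.le_zero.mp (hF.pderiv (i := i)).totalDegree_le)⟩
  choose e he using hconst
  have hgrad : ∀ v, grad (geomForm F) v = baseChange e := by
    intro v
    rw [grad_geomForm]
    funext i
    rw [he, aeval_C]
    rfl
  obtain ⟨v, hv, hFv, -⟩ := exists_common_zero hsK.ne_zero hsK.ne_zero hFK hFK one_pos one_pos
  obtain ⟨j, hj⟩ : ∃ j, e j ≠ 0 := by
    by_contra! h0
    refine hsK v hv hFv ?_
    rw [hgrad]
    funext i
    simp [baseChange, h0]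
  obtain ⟨i, hij⟩ := exists_ne j
  have ha : (Pi.single i 1 : Fin 3 → k) ≠ 0 := by simp
  refine ⟨Pi.single i 1, ha, ?_⟩
  by_contra hcon
  obtain ⟨w, -, -, -, hpar⟩ := exists_tangent_of_not_meetsTransversely hF ha hcon
  rw [hgrad] at hpar
  have := par_of_par_baseChange hpar i j
  simp [hij.symm] at this
  exact hj this

variable [Finite k]

lemma card_cast_eq_zero : ((Nat.card k : ℕ) : AlgebraicClosure k) = 0 := by
  have := Fintype.ofFinite k
  rw [Nat.card_eq_fintype_card, ← map_natCast (algebraMap k (AlgebraicClosure k)),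
    FiniteField.cast_card_eq_zero, map_zero]

/-- The coordinatewise `q`-th power of a vector is induced by a `k`-algebra homomorphism. -/
lemma exists_frobenius : ∃ φ : AlgebraicClosure k →ₐ[k] AlgebraicClosure k,
    ∀ v : Fin 3 → AlgebraicClosure k, v ^ Nat.card k = fun i => φ (v i) := by
  have := Fintype.ofFinite k
  refine ⟨FiniteField.frobeniusAlgHom k (AlgebraicClosure k), fun v => ?_⟩
  funext i
  rw [Nat.card_eq_fintype_card]
  rfl

lemma pow_card_dotProduct {a : Fin 3 → k} {v : Fin 3 → AlgebraicClosure k}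
    (h : baseChange a ⬝ᵥ v = 0) : baseChange a ⬝ᵥ v ^ Nat.card k = 0 := by
  obtain ⟨φ, hφ⟩ := exists_frobenius (k := k)
  rw [hφ]
  have := congrArg φ h
  simpa [dotProduct, baseChange] using this

lemma eval_geomForm_pow_card (F : MvPolynomial (Fin 3) k) {v : Fin 3 → AlgebraicClosure k}
    (h : eval v (geomForm F) = 0) : eval (v ^ Nat.card k) (geomForm F) = 0 := by
  obtain ⟨φ, hφ⟩ := exists_frobenius (k := k)
  rw [eval_geomForm] at h ⊢
  rw [hφ, ← comp_aeval_apply, h, map_zero]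

lemma par_grad_geomForm_pow_card (F : MvPolynomial (Fin 3) k) {a : Fin 3 → k}
    {v : Fin 3 → AlgebraicClosure k} (h : Par (baseChange a) (grad (geomForm F) v)) :
    Par (baseChange a) (grad (geomForm F) (v ^ Nat.card k)) := by
  obtain ⟨φ, hφ⟩ := exists_frobenius (k := k)
  intro i j
  have := congrArg φ (h i j)
  rw [grad_geomForm] at this ⊢
  simp only [hφ, ← comp_aeval_apply]
  simpa [baseChange] using this

/-- If no rational line is transverse to a smooth curve of degree `d` which is not Frobenius
nonclassical, then each of the rational lines contributes at least `2` to the intersection of the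
curve with the form of Stöhr and Voloch. Indeed, let `v` be a point of tangency of a rational line.
If `v` is rational, then the two curves are tangent to each other at `v`. Otherwise, the Frobenius
image of `v` is a second point of tangency of the same line. -/
theorem two_mul_card_le {d : ℕ} {F : MvPolynomial (Fin 3) k} (hF : F.IsHomogeneous d)
    (hd : 1 ≤ d) (hs : IsSmooth F) (hfrob : ¬ geomForm F ∣ frobForm (Nat.card k) (geomForm F))
    (h : ∀ a : Fin 3 → k, a ≠ 0 → ¬ MeetsTransversely F d a) :
    2 * Nat.card (ℙ k (Fin 3 → k)) ≤ d * (Nat.card k + (d - 1)) := by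
  classical
  have hFK := isHomogeneous_geomForm hF
  have hsK := hs.smoothForm hF
  have hirr := hsK.irreducible hFK hd
  choose v hv hFv hav hpar using fun ℓ : ℙ k (Fin 3 → k) =>
    exists_tangent_of_not_meetsTransversely hF ℓ.rep_nonzero (h ℓ.rep ℓ.rep_nonzero)
  have hw : ∀ ℓ : ℙ k (Fin 3 → k), ∃ w, baseChange ℓ.rep ⬝ᵥ w = 0 ∧ ¬ Par (v ℓ) w := fun ℓ =>
    exists_pair_of_line (baseChange_ne_zero ℓ.rep_nonzero) (hv ℓ)
  choose w haw hvw using hw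
  have := Fintype.ofFinite (ℙ k (Fin 3 → k))
  let ι := ℙ k (Fin 3 → k) ⊕ {ℓ : ℙ k (Fin 3 → k) // ¬ Par (v ℓ) (v ℓ ^ Nat.card k)}
  let L : ι → ℙ k (Fin 3 → k) := Sum.elim id Subtype.val
  let P : ι → Fin 3 → AlgebraicClosure k := Sum.elim v fun ℓ => v ℓ.1 ^ Nat.card k
  let D : Finset ι := (Finset.univ.filter fun ℓ => Par (v ℓ) (v ℓ ^ Nat.card k)).map
    Function.Embedding.inl
  have hP : ∀ i, P i ≠ 0 ∧ eval (P i) (geomForm F) = 0 ∧ baseChange (L i).rep ⬝ᵥ P i = 0 ∧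
      Par (baseChange (L i).rep) (grad (geomForm F) (P i)) := by
    rintro (ℓ | ⟨ℓ, hℓ⟩)
    · exact ⟨hv ℓ, hFv ℓ, hav ℓ, hpar ℓ⟩
    · exact ⟨pow_ne_zero _ (hv ℓ), eval_geomForm_pow_card F (hFv ℓ), pow_card_dotProduct (hav ℓ),
        par_grad_geomForm_pow_card F (hpar ℓ)⟩
  -- a point of the curve determines the line that is tangent there
  have hL : ∀ i j, Par (P i) (P j) → L i = L j := by
    intro i j hij
    obtain ⟨c, hc⟩ := hij.exists_smul (hP i).1
    have hj := (hP j).2.2.2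
    have hgi := hsK _ (hP i).1 (hP i).2.1
    have hgj := hsK _ (hP j).1 (hP j).2.1
    have hgrad : Par (grad (geomForm F) (P i)) (grad (geomForm F) (P j)) := by
      rw [hc, grad_smul_of_isHomogeneous hFK]
      exact (Par.refl _).smul_right _
    have := par_of_par_baseChange
      ((((hP i).2.2.2.trans hgrad hgi).trans hj.symm hgj))
    rw [← (L i).mk_rep, ← (L j).mk_rep, mk_eq_mk_iff_par]
    exact this
  have hPne : ∀ i j, i ≠ j → ¬ Par (P i) (P j) := by
    intro i j hij hp
    have hLij := hL i j hp
    rcases i with ℓ | ⟨ℓ, hℓ⟩ <;> rcases j with ℓ' | ⟨ℓ', hℓ'⟩ <;>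
      obtain rfl : ℓ = ℓ' := hLij
    · exact hij rfl
    · exact hℓ' hp
    · exact hℓ hp.symm
    · exact hij rfl
  have hGP : ∀ i, eval (P i) (frobForm (Nat.card k) (geomForm F)) = 0 := by
    intro i
    obtain ⟨s, hs'⟩ := (hP i).2.2.2.exists_smul (baseChange_ne_zero (L i).rep_nonzero)
    rw [eval_frobForm, hs', dotProduct_smul, dotProduct_comm, pow_card_dotProduct (hP i).2.2.1,
      smul_zero]
  have hFw : ∀ ℓ, grad (geomForm F) (v ℓ) ⬝ᵥ w ℓ = 0 := by
    intro ℓ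
    obtain ⟨s, hs'⟩ := (hpar ℓ).exists_smul (baseChange_ne_zero ℓ.rep_nonzero)
    rw [hs', smul_dotProduct, haw, smul_zero]
  have hG0 : frobForm (Nat.card k) (geomForm F) ≠ 0 := by
    intro h0
    rw [h0] at hfrob
    exact hfrob (dvd_zero _)
  have hbez := card_add_card_le_mul (v := P) (w := fun i => w (L i)) D (fun i => (hP i).1) hPne
    (by
      intro i hi
      obtain ⟨ℓ, -, rfl⟩ := Finset.mem_map.mp hi
      exact hvw ℓ) hirr.ne_zero hG0 hFK (isHomogeneous_frobForm hFK _)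
    (hirr.isRelPrime_iff_not_dvd.mpr hfrob) (fun i => (hP i).2.1) hGP
    (by
      intro i hi
      obtain ⟨ℓ, -, rfl⟩ := Finset.mem_map.mp hi
      exact hFw ℓ)
    (by
      intro i hi
      obtain ⟨ℓ, hℓ, rfl⟩ := Finset.mem_map.mp hi
      obtain ⟨c, hc⟩ := (Finset.mem_filter.mp hℓ).2.exists_smul (hv ℓ)
      rw [dirDeriv_frobForm card_cast_eq_zero]
      show v ℓ ^ Nat.card k ⬝ᵥ hess (geomForm F) (v ℓ) (w ℓ) = 0
      rw [hc, smul_dotProduct, dotProduct_hess hFK (hFw ℓ), smul_zero])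
  have hcard : Fintype.card ι + D.card = 2 * Nat.card (ℙ k (Fin 3 → k)) := by
    have h1 := Finset.card_filter_add_card_filter_not
      (s := (Finset.univ : Finset (ℙ k (Fin 3 → k)))) (fun ℓ => Par (v ℓ) (v ℓ ^ Nat.card k))
    have h2 : Fintype.card ι = Fintype.card (ℙ k (Fin 3 → k)) +
        (Finset.univ.filter fun ℓ => ¬ Par (v ℓ) (v ℓ ^ Nat.card k)).card := by
      rw [Fintype.card_sum, Fintype.card_subtype]
    rw [h2, Finset.card_map, Nat.card_eq_fintype_card (α := ℙ k (Fin 3 → k))]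
    rw [Finset.card_univ] at h1
    omega
  rwa [hcard] at hbez

end Counting

end PlaneCurve

theorem theorem1 {k : Type*} [Field k] [Finite k] (hchar : ringChar k ≠ 2)
    (d : ℕ) (hd : 1 ≤ d) (hdq : d ≤ Nat.card k + 1)
    (F : MvPolynomial (Fin 3) k) (hF : F.IsHomogeneous d)
    (hsmooth : PlaneCurve.IsSmooth F)
    (hrefl : PlaneCurve.IsReflexive (PlaneCurve.geomPoints F)) :
    ∃ a : Fin 3 → k, a ≠ 0 ∧ PlaneCurve.MeetsTransversely F d a := by
  open PlaneCurve in
  obtain rfl | hd2 := hd.eq_or_lt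
  · exact exists_meetsTransversely_of_degree_one hF hsmooth
  have hFK := isHomogeneous_geomForm hF
  have hsK := hsmooth.smoothForm hF
  rw [geomPoints_eq_curve] at hrefl
  have hfrob : ¬ geomForm F ∣ frobForm (Nat.card k) (geomForm F) := by
    rcases hrefl with ⟨a, ha, hline⟩ | ⟨hdual, hid⟩
    · -- An irreducible curve of degree at least `2` is not a line.
      have hdvd : geomForm F ∣ lin a :=
        (vanishesOn_curve_iff (hsK.irreducible hFK hd) hFK (isHomogeneous_lin a)).mp fun P hP => by
          rw [hline] at hP
          rw [eval_lin]
          exact hP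
      have := le_of_dvd_of_isHomogeneous (lin_ne_zero ha) hFK (isHomogeneous_lin a) hdvd
      omega
    · exact not_dvd_frobForm card_cast_eq_zero hsK hFK hd2 hdual hid
  by_contra! hcon
  have hle := two_mul_card_le hF hd hsmooth hfrob hcon
  rw [Projectivization.card_of_finrank k (Fin 3 → k) (n := 3) (by simp)] at hle
  simp only [Finset.sum_range_succ, Finset.sum_range_zero] at hle
  -- `d * (q + d - 1) ≤ (q + 1) * (2 * q) < 2 * (1 + q + q ^ 2)`
  have hbound : d * (Nat.card k + (d - 1)) ≤ (Nat.card k + 1) * (Nat.card k + Nat.card k) :=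
    Nat.mul_le_mul hdq (by omega)
  nlinarith
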